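/- **Quasitriviality Theorem.** Let $I\subset\mathbb R$ be open and let $c,p$ be smooth real functions on $I$; put $s=c\,c'''/3456$. Work with smooth functions of finitely many jet variables $u,u_x,u_{xx},\dots$ on the domain $u\in I$, $u_x\neq0$, with total derivative $\partial_x$ and variational derivative $\frac{\delta H}{\delta u(x)}=\sum_k(-1)^k\partial_x^k\frac{\partial h}{\partial u^{(k)}}$ of $H=\int h\,dx$; functionals are identified when their densities differ by a total $x$-derivative. The Poisson bracket is $\{u(x),u(y)\}=\delta'(x-y)$, so that $\{u(x),H\}=\partial_x\frac{\delta H}{\delta u(x)}$ and $\{F(x),H\}=\sum_k\frac{\partial F}{\partial u^{(k)}}\partial_x^k\{u(x),H\}$ for a function $F$ of the jet of $u$ at $x$. For smooth $f$ on $I$ let $H_f=\int h_f\,dx$, $$h_f=f-\frac{\epsilon^2}{24}c f'''u_x^2+\epsilon^4\Big[\Big(pf'''+\frac{c^2f^{(4)}}{480}\Big)u_{xx}^2-\Big(\frac{cc''f^{(4)}}{1152}+\frac{cc'f^{(5)}}{1152}+\frac{c^2f^{(6)}}{3456}+\frac{p'f^{(4)}}6+\frac{pf^{(5)}}6-sf'''\Big)u_x^4\Big],$$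 where all functions are evaluated at $u$. Let $$K=\int\Big[\frac{\epsilon}{24}\,c(u)\,u_x\log|u_x|+\epsilon^3\Big(\frac{c(u)^2}{5760}\frac{u_{xx}^3}{u_x^3}-\frac{p(u)}4\frac{u_{xx}^2}{u_x}\Big)\Big]dx .$$ 1. The canonical transformation generated by $K$, i.e. the formal power series in $\epsilon$ $$u\mapsto v=u+\epsilon\{u(x),K\}+\frac{\epsilon^2}2\{\{u(x),K\},K\}+\cdots,$$ satisfies $H_f=\int f(v)\,dx+O(\epsilon^6)$ for every smooth $f$ on $I$ (equality of the coefficients of $\epsilon^k$, $k<6$, as functionals). 2. The transformation $v\mapsto u$ generated in the same way by $-K$ is, modulo $O(\epsilon^6)$, the substitution, rational in the derivatives of $v$ and independent of $f$, $$\begin{aligned}u={}&v+\frac{\epsilon^2}{24}\partial_x\Big(c\frac{v_{xx}}{v_x}+c'v_x\Big)+\epsilon^4\partial_x\Big[c^2\,\partial_x\Big(\frac{v_{xx}^3}{360v_x^4}-\frac{7v_{xx}v_{xxx}}{1920v_x^3}+\frac{v_{xxxx}}{1152v_x^2}\Big)\\&+cc'\Big(\frac{47v_{xx}^3}{5760v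_x^3}-\frac{37v_{xx}v_{xxx}}{2880v_x^2}+\frac{5v_{xxxx}}{1152v_x}\Big)+c'^2\Big(\frac{v_{xxx}}{384}-\frac{v_{xx}^2}{5760v_x}\Big)+cc''\Big(\frac{v_{xxx}}{144}-\frac{v_{xx}^2}{360v_x}\Big)\\&+\frac1{1152}\big(7c'c''v_xv_{xx}+c''^2v_x^3+6cc'''v_xv_{xx}+c'c'''v_x^3+cc^{(4)}v_x^3\big)\\&+p\Big(\frac{v_{xx}^3}{2v_x^3}-\frac{v_{xx}v_{xxx}}{v_x^2}+\frac{v_{xxxx}}{2v_x}\Big)+p'v_{xxx}+\frac12p''v_xv_{xx}\Big],\qquad c=c(v),\ p=p(v).\end{aligned}$$ 3. The transformations in 1 and 2 are inverse to each other modulo $O(\epsilon^6)$: applying one and then the other to any smooth function $w$ on an open subset of $\mathbb R$ with values in $I$ and $w'\neq0$ gives $w+O(\epsilon^6)$ at each point. 4. Let $f$ be smooth on $I$, $a=f''$, and let $\Omega\subset\mathbb R^2$ be open. For every smooth solution $v:\Omega\to I$ of $v_s+a(v)v_x=0$ which is monotone in the sense that $v_x\ne0$ on $\Omega$, the function $u$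 given by the formula in 2 satisfies $$u_s+\partial_x\frac{\delta H_f}{\delta u(x)}=O(\epsilon^6).$$ The same holds for every family $v(\epsilon,x,s)$, smooth near $\{0\}\times\Omega$, with $v|_{\epsilon=0}\in I$ and $v_x|_{\epsilon=0}\neq0$ on $\Omega$, such that $v_s+a(v)v_x=O(\epsilon^6)$. Vice versa, if $u(\epsilon,x,s)$ is a family, smooth near $\{0\}\times\Omega$, with $u|_{\epsilon=0}\in I$ and $u_x|_{\epsilon=0}\ne0$ on $\Omega$, and $u_s+\partial_x\frac{\delta H_f}{\delta u(x)}=O(\epsilon^6)$, then the function $v$ obtained from $u$ by the transformation in 1, truncated modulo $O(\epsilon^6)$, satisfies $v_s+a(v)v_x=O(\epsilon^6)$. Here $O(\epsilon^6)$ is understood for $\epsilon\to0$ at each point of $\Omega$. -/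

import Mathlib

open Filter Topology Asymptotics Set
open scoped ContDiff Nat

noncomputable section

namespace Quasitriviality

/-! ### Formal calculus of variations in one dependent variable

A jet is a sequence `z`, where `z k` stands for the `k`-th `x`-derivative of `u`. -/

/-- Infinite jets `(u, u_x, u_xx, …)`. -/
abbrev Jet : Type := ℕ → ℝ

/-- Functions of the jet variables. -/
abbrev JetFun : Type := Jet → ℝ

/-- The jet variable `u^{(k)}`. -/
def coord (k : ℕ) : JetFun := fun z => z k

/-- The partial derivative `∂h/∂u^{(k)}`. -/
def pderiv (k : ℕ) (h : JetFun) : JetFun :=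
  fun z => deriv (fun t => h (Function.update z k t)) (z k)

/-- The total derivative `∂_x h = ∑ₖ u^{(k+1)} ∂h/∂u^{(k)}`
(a finite sum if `h` depends on finitely many jet variables). -/
def totalD (h : JetFun) : JetFun :=
  fun z => ∑ᶠ k : ℕ, z (k + 1) * pderiv k h z

/-- The Euler–Lagrange operator `∑ₖ (-1)ᵏ ∂_xᵏ ∂h/∂u^{(k)}`, i.e. the variational derivative
`δH/δu(x)` of `H = ∫ h dx`. -/
def euler (h : JetFun) : JetFun :=
  fun z => ∑ᶠ k : ℕ, (-1 : ℝ) ^ k * (totalD^[k] (pderiv k h)) z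

/-- The derivative `∑ₖ (∂_xᵏ w) ∂g/∂u^{(k)}` of `g` along the evolutionary field `u ↦ w`. -/
def evol (w g : JetFun) : JetFun :=
  fun z => ∑ᶠ k : ℕ, (totalD^[k] w) z * pderiv k g z

/-- The domain `u ∈ I`, `u_x ≠ 0` of the jet space. -/
def Dom (I : Set ℝ) : Set Jet := {z | z 0 ∈ I ∧ z 1 ≠ 0}

/-- On `Dom I` the function `g` is a smooth function of finitely many jet variables. -/
def IsLocal (I : Set ℝ) (g : JetFun) : Prop :=
  ∃ (N : ℕ) (G : (Fin (N + 2) → ℝ) → ℝ),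
    ContDiffOn ℝ ∞ G {y | y 0 ∈ I ∧ y 1 ≠ 0} ∧ ∀ z ∈ Dom I, g z = G (fun i => z i)

/-- Equality `∫ h₁ dx = ∫ h₂ dx` of local functionals: the densities differ by the total
`x`-derivative of a local function. -/
def SameFunctional (I : Set ℝ) (h₁ h₂ : JetFun) : Prop :=
  ∃ g : JetFun, IsLocal I g ∧ ∀ z ∈ Dom I, h₁ z - h₂ z = totalD g z

/-! ### Formal power series in `ε` -/

/-- Formal power series in `ε` whose coefficients are functions of the jet variables. -/
abbrev EpsFun : Type := PowerSeries JetFun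

/-- `{u(x), H} = ∂_x δH/δu(x)` for `H = ∫ h dx` and `{u(x), u(y)} = δ'(x - y)`. -/
def hamField (h : EpsFun) : EpsFun :=
  PowerSeries.mk fun n => totalD (euler (PowerSeries.coeff n h))

/-- The bracket `{F(x), K} = ∑ₖ ∂F/∂u^{(k)} ∂_xᵏ {u(x), K}` of a function `F` of the jet of `u` at `x`
with the functional `K` of density `κ`, extended to power series in `ε`. -/
def bracket (F κ : EpsFun) : EpsFun :=
  PowerSeries.mk fun n => ∑ q ∈ Finset.HasAntidiagonal.antidiagonal n,
    evol (PowerSeries.coeff q.1 (hamField κ)) (PowerSeries.coeff q.2 F)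

/-- The canonical transformation generated by `K = ∫ κ dx`,
`u + ε {u(x), K} + (ε² / 2!) {{u(x), K}, K} + (ε³ / 3!) {{{u(x), K}, K}, K} + …`
(terms with more than `n` brackets do not contribute to the coefficient of `εⁿ`). -/
def canonical (κ : EpsFun) : EpsFun :=
  PowerSeries.mk fun n => ∑ m ∈ Finset.range (n + 1),
    ((m ! : ℝ)⁻¹) • PowerSeries.coeff n
      (PowerSeries.X ^ m * (fun F => bracket F κ)^[m] (PowerSeries.C (coord 0)))

/-- `f(V)` for a power series `V = u + O(ε)`, as its Taylor series
`∑ⱼ f^{(j)}(u) (V - u)ʲ / j!`. -/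
def applyFun (f : ℝ → ℝ) (V : EpsFun) : EpsFun :=
  PowerSeries.mk fun n => fun z => ∑ j ∈ Finset.range (n + 1),
    iteratedDeriv j f (z 0) / (j ! : ℝ) *
      PowerSeries.coeff n ((V - PowerSeries.C (coord 0)) ^ j) z

/-! ### The Hamiltonians and the explicit substitution -/

/-- The density of `K`:
`ε c u_x log u_x / 24 + ε³ (c² u_xx³ / (5760 u_x³) - p u_xx² / (4 u_x))`.
Here `Real.log u_x` is `log |u_x|`. -/
def densityK (c p : ℝ → ℝ) : EpsFun :=
  PowerSeries.monomial 1 (fun z : Jet => 1 / 24 * c (z 0) * z 1 * Real.log (z 1)) +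
  PowerSeries.monomial 3 (fun z : Jet =>
    c (z 0) ^ 2 / 5760 * (z 2 ^ 3 / z 1 ^ 3) - p (z 0) / 4 * (z 2 ^ 2 / z 1))

/-- The density `h_f` of the perturbed Hamiltonian `H_f` with functional parameters `c, p, s`. -/
def densityH (c p s f : ℝ → ℝ) : EpsFun :=
  PowerSeries.monomial 0 (fun z : Jet => f (z 0)) +
  PowerSeries.monomial 2 (fun z : Jet => -(1 / 24) * c (z 0) * iteratedDeriv 3 f (z 0) * z 1 ^ 2) +
  PowerSeries.monomial 4 (fun z : Jet =>
    (p (z 0) * iteratedDeriv 3 f (z 0) + c (z 0) ^ 2 * iteratedDeriv 4 f (z 0) / 480) * z 2 ^ 2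
    - (c (z 0) * iteratedDeriv 2 c (z 0) * iteratedDeriv 4 f (z 0) / 1152
      + c (z 0) * iteratedDeriv 1 c (z 0) * iteratedDeriv 5 f (z 0) / 1152
      + c (z 0) ^ 2 * iteratedDeriv 6 f (z 0) / 3456
      + iteratedDeriv 1 p (z 0) * iteratedDeriv 4 f (z 0) / 6
      + p (z 0) * iteratedDeriv 5 f (z 0) / 6
      - s (z 0) * iteratedDeriv 3 f (z 0)) * z 1 ^ 4)

/-- The choice `s = c c''' / 3456`. -/
def sFun (c : ℝ → ℝ) : ℝ → ℝ := fun u => c u * iteratedDeriv 3 c u / 3456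

/-- The expression in square brackets, under `∂_x`, in the `ε⁴`-term of the substitution. -/
def quasiBracket (c p : ℝ → ℝ) : JetFun := fun z =>
  c (z 0) ^ 2 * totalD (fun y : Jet =>
      y 2 ^ 3 / (360 * y 1 ^ 4) - 7 * y 2 * y 3 / (1920 * y 1 ^ 3) + y 4 / (1152 * y 1 ^ 2)) z
  + c (z 0) * iteratedDeriv 1 c (z 0) *
      (47 * z 2 ^ 3 / (5760 * z 1 ^ 3) - 37 * z 2 * z 3 / (2880 * z 1 ^ 2)
        + 5 * z 4 / (1152 * z 1))
  + iteratedDeriv 1 c (z 0) ^ 2 * (z 3 / 384 - z 2 ^ 2 / (5760 * z 1))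
  + c (z 0) * iteratedDeriv 2 c (z 0) * (z 3 / 144 - z 2 ^ 2 / (360 * z 1))
  + 1 / 1152 * (7 * iteratedDeriv 1 c (z 0) * iteratedDeriv 2 c (z 0) * z 1 * z 2
      + iteratedDeriv 2 c (z 0) ^ 2 * z 1 ^ 3
      + 6 * c (z 0) * iteratedDeriv 3 c (z 0) * z 1 * z 2
      + iteratedDeriv 1 c (z 0) * iteratedDeriv 3 c (z 0) * z 1 ^ 3
      + c (z 0) * iteratedDeriv 4 c (z 0) * z 1 ^ 3)
  + p (z 0) * (z 2 ^ 3 / (2 * z 1 ^ 3) - z 2 * z 3 / z 1 ^ 2 + z 4 / (2 * z 1))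
  + iteratedDeriv 1 p (z 0) * z 3
  + iteratedDeriv 2 p (z 0) * (z 1 * z 2 / 2)

/-- The explicit substitution `v ↦ u = v + (ε²/24) ∂_x (c v_xx / v_x + c' v_x) + ε⁴ ∂_x [ … ]`,
which is rational in the derivatives of `v`. -/
def quasi (c p : ℝ → ℝ) : EpsFun :=
  PowerSeries.monomial 0 (coord 0) +
  PowerSeries.monomial 2 (fun z : Jet => 1 / 24 *
    totalD (fun y : Jet => c (y 0) * (y 2 / y 1) + iteratedDeriv 1 c (y 0) * y 1) z) +
  PowerSeries.monomial 4 (totalD (quasiBracket c p))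

/-! ### Substitutions and solutions modulo `O(ε⁶)` -/

/-- The jet `(w(x), w'(x), w''(x), …)` of a function at a point. -/
def jet (w : ℝ → ℝ) (x : ℝ) : Jet := fun k => iteratedDeriv k w x

/-- The value of a power series in `ε`, modulo `O(ε⁶)`, at a number `ε` and a jet. -/
def eval6 (F : EpsFun) (ε : ℝ) (z : Jet) : ℝ :=
  ∑ k ∈ Finset.range 6, ε ^ k * PowerSeries.coeff k F z

/-- The substitution `F`, modulo `O(ε⁶)`, applied to a family `w = w(ε, x, s)`:
`(ε, x, s) ↦ F(w, w_x, w_xx, …; ε)`. -/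
def substitute (F : EpsFun) (w : ℝ → ℝ → ℝ → ℝ) : ℝ → ℝ → ℝ → ℝ :=
  fun ε x s => eval6 F ε (jet (fun y => w ε y s) x)

/-- A family `w = w(ε, x, s)`, smooth in all variables near `{0} × Ω`, with values in `I` and
monotone in `x` for `ε = 0`. -/
def IsMonotoneFamily (I : Set ℝ) (Ω : Set (ℝ × ℝ)) (w : ℝ → ℝ → ℝ → ℝ) : Prop :=
  (∃ U : Set (ℝ × ℝ × ℝ), IsOpen U ∧ (∀ q ∈ Ω, ((0 : ℝ), q) ∈ U) ∧
    ContDiffOn ℝ ∞ (fun r : ℝ × ℝ × ℝ => w r.1 r.2.1 r.2.2) U) ∧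
  ∀ x s, (x, s) ∈ Ω → w 0 x s ∈ I ∧ deriv (fun y => w 0 y s) x ≠ 0

/-- `v_s + a(v) v_x = O(ε⁶)` at all points of `Ω`, for a family `v = v(ε, x, s)`. -/
def SolvesUnperturbed (a : ℝ → ℝ) (Ω : Set (ℝ × ℝ)) (v : ℝ → ℝ → ℝ → ℝ) : Prop :=
  ∀ x s, (x, s) ∈ Ω →
    (fun ε => deriv (fun σ => v ε x σ) s + a (v ε x s) * deriv (fun y => v ε y s) x)
      =O[𝓝 0] fun ε : ℝ => ε ^ 6

/-- `u_s + ∂_x δH/δu(x) = O(ε⁶)` at all points of `Ω`, for a family `u = u(ε, x, s)` and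
`H = ∫ h dx`. -/
def SolvesHamiltonian (h : EpsFun) (Ω : Set (ℝ × ℝ)) (u : ℝ → ℝ → ℝ → ℝ) : Prop :=
  ∀ x s, (x, s) ∈ Ω →
    (fun ε => deriv (fun σ => u ε x σ) s + eval6 (hamField h) ε (jet (fun y => u ε y s) x))
      =O[𝓝 0] fun ε : ℝ => ε ^ 6

end Quasitriviality

end

open Quasitriviality

/-!
Since `K` is odd in `ε`, a canonical transformation is an even series, and modulo `O(ε⁶)` only its
coefficients of `ε⁰`, `ε²`, `ε⁴` matter. Composition of two such substitutions, and the derivative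
of a substitution along an evolution equation, are then given by three differential expressions,
obtained by Taylor expansion in the jet variables. A smooth family that is `O(ε⁶)` at each point has
`O(ε⁶)` derivatives in `x`, so an equation that holds modulo `O(ε⁶)` may be differentiated in `x`
and substituted into a jet. This reduces the inverse property to the fact that the flows of `K` and
`-K` cancel, and the transport of solutions to the statement that the substitution intertwines the
two evolution equations coefficient by coefficient.

What remains are identities between polynomials in `log |u_x|`, `1 / u_x`, the jet variables and the
derivatives of `c`, `p`, `f`, which are decided by computing normal forms over `ℚ`. Equality of
functionals in the first part becomes such an identity once a primitive of the difference of the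
densities is written down; it is found by integrating by parts.
-/

noncomputable section

namespace Quasitriviality

/-! ### Directional derivatives and Taylor expansions -/

section DirectionalDerivative

variable {E : Type*} [NormedAddCommGroup E] [NormedSpace ℝ E] {O : Set E} {Φ : E → ℝ} {r : E}

/-- The derivative of `Φ` in the constant direction `e`, as an operator on functions so that it can
be iterated. -/
def dirDeriv (e : E) (Φ : E → ℝ) : E → ℝ :=
  fun r => fderiv ℝ Φ r e

lemma contDiffOn_dirDeriv (hO : IsOpen O) (hΦ : ContDiffOn ℝ ∞ Φ O) (e : E) :
    ContDiffOn ℝ ∞ (dirDeriv e Φ) O :=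
  (hΦ.fderiv_of_isOpen hO (by simp)).clm_apply contDiffOn_const

lemma contDiffOn_iterate_dirDeriv (hO : IsOpen O) (hΦ : ContDiffOn ℝ ∞ Φ O) (e : E) (n : ℕ) :
    ContDiffOn ℝ ∞ ((dirDeriv e)^[n] Φ) O := by
  induction n with
  | zero => exact hΦ
  | succ n ih =>
    rw [Function.iterate_succ_apply']
    exact contDiffOn_dirDeriv hO ih e

lemma dirDeriv_congr {Ψ : E → ℝ} (hO : IsOpen O) (h : EqOn Φ Ψ O) (e : E) :
    EqOn (dirDeriv e Φ) (dirDeriv e Ψ) O := fun r hr => by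
  rw [dirDeriv, dirDeriv, (h.eventuallyEq_of_mem (hO.mem_nhds hr)).fderiv_eq]

lemma hasDerivAt_comp_dirDeriv (hO : IsOpen O) (hΦ : ContDiffOn ℝ ∞ Φ O) {γ : ℝ → E} {e : E}
    {t : ℝ} (ht : γ t ∈ O) (hγ : HasDerivAt γ e t) :
    HasDerivAt (fun s => Φ (γ s)) (dirDeriv e Φ (γ t)) t :=
  ((hΦ.contDiffAt (hO.mem_nhds ht)).differentiableAt (by simp)).hasFDerivAt.comp_hasDerivAt t hγ

lemma dirDeriv_dirDeriv (hO : IsOpen O) (hΦ : ContDiffOn ℝ ∞ Φ O) (e e' : E) (hr : r ∈ O) :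
    dirDeriv e (dirDeriv e' Φ) r = fderiv ℝ (fderiv ℝ Φ) r e e' := by
  have h : DifferentiableAt ℝ (fderiv ℝ Φ) r :=
    ((hΦ.fderiv_of_isOpen hO (m := ∞) (by simp)).contDiffAt (hO.mem_nhds hr)).differentiableAt
      (by simp)
  change fderiv ℝ (fun x => fderiv ℝ Φ x e') r e = _
  rw [fderiv_clm_apply h (differentiableAt_const e')]
  simp

lemma dirDeriv_comm (hO : IsOpen O) (hΦ : ContDiffOn ℝ ∞ Φ O) (e e' : E) :
    EqOn (dirDeriv e (dirDeriv e' Φ)) (dirDeriv e' (dirDeriv e Φ)) O := fun r hr => by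
  have h : ContDiffAt ℝ (2 : ℕ) Φ r := contDiffAt_infty.1 (hΦ.contDiffAt (hO.mem_nhds hr)) 2
  rw [dirDeriv_dirDeriv hO hΦ _ _ hr, dirDeriv_dirDeriv hO hΦ _ _ hr]
  exact (h.isSymmSndFDerivAt (by simp)) e e'

lemma iterate_dirDeriv_comm (hO : IsOpen O) (hΦ : ContDiffOn ℝ ∞ Φ O) (e e' : E) (n : ℕ) :
    EqOn ((dirDeriv e)^[n] (dirDeriv e' Φ)) (dirDeriv e' ((dirDeriv e)^[n] Φ)) O := by
  induction n with
  | zero => exact eqOn_refl _ _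
  | succ n ih =>
    simp only [Function.iterate_succ_apply']
    exact (dirDeriv_congr hO ih e).trans
      (dirDeriv_comm hO (contDiffOn_iterate_dirDeriv hO hΦ e n) e e')

lemma iteratedDeriv_comp_eq_dirDeriv (hO : IsOpen O) (hΦ : ContDiffOn ℝ ∞ Φ O) {γ : ℝ → E} {e : E}
    (hγ : ∀ t, HasDerivAt γ e t) (k : ℕ) {t : ℝ} (ht : γ t ∈ O) :
    iteratedDeriv k (fun t => Φ (γ t)) t = (dirDeriv e)^[k] Φ (γ t) := by
  induction k generalizing t with
  | zero => simp
  | succ k ih =>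
    have h : iteratedDeriv k (fun t => Φ (γ t)) =ᶠ[𝓝 t] fun t => (dirDeriv e)^[k] Φ (γ t) := by
      filter_upwards [(hγ t).continuousAt.preimage_mem_nhds (hO.mem_nhds ht)] with t' ht'
        using ih ht'
    rw [iteratedDeriv_succ, h.deriv_eq, Function.iterate_succ_apply',
      (hasDerivAt_comp_dirDeriv hO (contDiffOn_iterate_dirDeriv hO hΦ e k) ht (hγ t)).deriv]

lemma hasDerivAt_add_smul (q v : E) (t : ℝ) : HasDerivAt (fun s : ℝ => q + s • v) v t := by
  simpa using ((hasDerivAt_id t).smul_const v).const_add q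

lemma exists_sub_taylor_eq (hO : IsOpen O) (hΦ : ContDiffOn ℝ ∞ Φ O) {q v : E} {t : ℝ} {n : ℕ}
    (hqt : ∀ s ∈ uIcc 0 t, q + s • v ∈ O) :
    ∃ s ∈ uIcc 0 t, Φ (q + t • v) - ∑ k ∈ Finset.range (n + 1),
        ((k ! : ℝ)⁻¹ * t ^ k) * (dirDeriv v)^[k] Φ q
      = (dirDeriv v)^[n + 1] Φ (q + s • v) * t ^ (n + 1) / (n + 1)! := by
  rcases eq_or_ne t 0 with rfl | ht
  · exact ⟨0, by simp, by simp [Finset.sum_range_succ']⟩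
  have hline : ContDiff ℝ ∞ fun s : ℝ => q + s • v := by fun_prop
  have hderiv (k : ℕ) {s : ℝ} (hs : s ∈ uIcc 0 t) := iteratedDeriv_comp_eq_dirDeriv hO hΦ
    (hasDerivAt_add_smul q v) k (hqt s hs)
  have hsmooth (n : ℕ) {s : ℝ} (hs : s ∈ uIcc 0 t) :
      ContDiffAt ℝ n (fun s : ℝ => Φ (q + s • v)) s :=
    contDiffAt_infty.1 ((hΦ.contDiffAt (hO.mem_nhds (hqt s hs))).comp s hline.contDiffAt) n
  obtain ⟨s, hs, h⟩ := taylor_mean_remainder_lagrange_iteratedDeriv (n := n) ht.symm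
    fun s hs => (hsmooth (n + 1) hs).contDiffWithinAt
  refine ⟨s, Ioo_subset_Icc_self hs, ?_⟩
  rw [hderiv _ (Ioo_subset_Icc_self hs), sub_zero, taylor_within_apply] at h
  rw [← h]
  congr 1
  refine Finset.sum_congr rfl fun k _ => ?_
  rw [iteratedDerivWithin_eq_iteratedDeriv (uniqueDiffOn_uIcc ht.symm)
    (hsmooth k left_mem_uIcc) left_mem_uIcc, hderiv k left_mem_uIcc]
  simp

lemma isBigO_sub_taylor (hO : IsOpen O) (hΦ : ContDiffOn ℝ ∞ Φ O) {p : E} (hp : p ∈ O) (v : E)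
    (n : ℕ) :
    (fun q : E × ℝ => Φ (q.1 + q.2 • v) - ∑ k ∈ Finset.range n,
      ((k ! : ℝ)⁻¹ * q.2 ^ k) * (dirDeriv v)^[k] Φ q.1) =O[𝓝 (p, 0)] fun q => q.2 ^ n := by
  have hshift : Continuous fun q : E × ℝ => q.1 + q.2 • v := by fun_prop
  have hcont : ContinuousAt (fun q : E × ℝ => (dirDeriv v)^[n] Φ (q.1 + q.2 • v)) (p, 0) := by
    refine ContinuousAt.comp ?_ hshift.continuousAt
    simpa using (contDiffOn_iterate_dirDeriv hO hΦ v n).continuousOn.continuousAt (hO.mem_nhds hp)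
  obtain ⟨C, hC⟩ := hcont.norm.isBoundedUnder_le
  have hmem : ∀ᶠ q : E × ℝ in 𝓝 (p, 0), q.1 + q.2 • v ∈ O :=
    hshift.continuousAt.preimage_mem_nhds (by simpa using hO.mem_nhds hp)
  obtain ⟨δ, hδ, hball⟩ := Metric.eventually_nhds_iff_ball.1 (hmem.and (eventually_map.1 hC))
  refine IsBigO.of_bound C ?_
  filter_upwards [Metric.ball_mem_nhds _ hδ] with ⟨q, t⟩ hqt
  have hseg : ∀ s ∈ uIcc 0 t, (q, s) ∈ Metric.ball (p, (0 : ℝ)) δ := fun s hs => by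
    rw [← ball_prod_same] at hqt ⊢
    refine ⟨hqt.1, mem_ball_zero_iff.2 ?_⟩
    exact (by simpa using abs_sub_left_of_mem_uIcc hs : |s| ≤ |t|).trans_lt
      (mem_ball_zero_iff.1 hqt.2)
  rcases n with _ | n
  · simpa using (hball _ hqt).2
  obtain ⟨s, hs, h⟩ := exists_sub_taylor_eq (n := n) hO hΦ fun s hs => (hball _ (hseg s hs)).1
  rw [h, norm_div, norm_mul]
  refine (div_le_self (by positivity) ?_).trans ?_
  · rw [Real.norm_natCast]
    exact_mod_cast Nat.one_le_iff_ne_zero.2 (Nat.factorial_ne_zero _)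
  · exact mul_le_mul_of_nonneg_right (hball _ (hseg s hs)).2 (norm_nonneg _)

end DirectionalDerivative

lemma contDiffOn_iteratedDeriv {I : Set ℝ} (hI : IsOpen I) {g : ℝ → ℝ} (hg : ContDiffOn ℝ ∞ g I)
    (n : ℕ) : ContDiffOn ℝ ∞ (iteratedDeriv n g) I := by
  induction n with
  | zero => simpa using hg
  | succ n ih =>
    rw [iteratedDeriv_succ]
    exact ih.deriv_of_isOpen hI (by simp)

lemma hasDerivAt_iteratedDeriv {I : Set ℝ} (hI : IsOpen I) {g : ℝ → ℝ} (hg : ContDiffOn ℝ ∞ g I)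
    (n : ℕ) {x : ℝ} (hx : x ∈ I) :
    HasDerivAt (iteratedDeriv n g) (iteratedDeriv (n + 1) g x) x := by
  rw [iteratedDeriv_succ]
  exact (((contDiffOn_iteratedDeriv hI hg n).contDiffAt (hI.mem_nhds hx)).differentiableAt
    (by simp)).hasDerivAt

lemma eq_zero_of_sum_mul_pow_isBigO {n : ℕ} {a : ℕ → ℝ}
    (h : (fun ε : ℝ => ∑ k ∈ Finset.range n, a k * ε ^ k) =O[𝓝[≠] 0] fun ε => ε ^ n) {k : ℕ}
    (hk : k < n) : a k = 0 := by
  induction n generalizing a k with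
  | zero => exact absurd hk k.not_lt_zero
  | succ n ih =>
    have hsum (ε : ℝ) : ∑ k ∈ Finset.range (n + 1), a k * ε ^ k
        = a 0 + ε * ∑ k ∈ Finset.range n, a (k + 1) * ε ^ k := by
      rw [Finset.sum_range_succ', Finset.mul_sum, add_comm]
      simp only [pow_zero, mul_one, pow_succ]
      congr 1
      exact Finset.sum_congr rfl fun _ _ => by ring
    simp only [hsum] at h
    have hzero : a 0 = 0 := by
      have hlim : Tendsto (fun ε : ℝ => ε ^ (n + 1)) (𝓝[≠] 0) (𝓝 0) :=
        ((continuous_pow (n + 1)).tendsto' 0 0 (by simp)).mono_left nhdsWithin_le_nhds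
      have hcont : Continuous fun ε : ℝ => a 0 + ε * ∑ k ∈ Finset.range n, a (k + 1) * ε ^ k := by
        fun_prop
      exact tendsto_nhds_unique
        ((hcont.tendsto' 0 (a 0) (by simp)).mono_left nhdsWithin_le_nhds) (h.trans_tendsto hlim)
    rcases k with _ | k
    · exact hzero
    refine ih (a := fun k => a (k + 1)) ?_ (Nat.succ_lt_succ_iff.1 hk)
    refine ((isBigO_refl (fun ε : ℝ => ε⁻¹) (𝓝[≠] 0)).mul h).congr' ?_ ?_ <;>
      filter_upwards [self_mem_nhdsWithin] with ε hε
    · rw [hzero, zero_add, inv_mul_cancel_left₀ hε]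
    · rw [pow_succ', inv_mul_cancel_left₀ hε]

lemma isBigO_pow_iff {g : ℝ → ℝ} {U : Set ℝ} (hU : IsOpen U) (h0 : (0 : ℝ) ∈ U)
    (hg : ContDiffOn ℝ ∞ g U) (n : ℕ) :
    g =O[𝓝 0] (fun ε => ε ^ n) ↔ ∀ k < n, iteratedDeriv k g 0 = 0 := by
  have hderiv (k : ℕ) : iteratedDeriv k g 0 = (dirDeriv 1)^[k] g 0 :=
    iteratedDeriv_comp_eq_dirDeriv hU hg hasDerivAt_id k h0
  have htaylor : (fun ε => g ε - ∑ k ∈ Finset.range n, ((k ! : ℝ)⁻¹ * iteratedDeriv k g 0) * ε ^ k)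
      =O[𝓝 0] fun ε => ε ^ n := by
    have hcont : Tendsto (fun ε : ℝ => ((0 : ℝ), ε)) (𝓝 0) (𝓝 (0, 0)) :=
      (Continuous.prodMk_right (0 : ℝ)).tendsto 0
    refine ((isBigO_sub_taylor hU hg h0 1 n).comp_tendsto hcont).congr_left fun ε => ?_
    simp [hderiv, mul_right_comm]
  refine ⟨fun h k hk => ?_, fun h => ?_⟩
  · have hpoly := ((h.sub htaylor).congr_left fun ε => sub_sub_cancel _ _).mono
      (nhdsWithin_le_nhds (s := {0}ᶜ))
    have := eq_zero_of_sum_mul_pow_isBigO hpoly hk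
    exact (mul_eq_zero.1 this).resolve_left (by positivity)
  · refine htaylor.congr_left fun ε => ?_
    rw [Finset.sum_eq_zero fun k hk => by rw [h k (Finset.mem_range.1 hk), mul_zero, zero_mul],
      sub_zero]

/-! ### Local functions -/

section Local

variable {I : Set ℝ} {f g g' : JetFun} {z : Jet}

lemma isOpen_dom (hI : IsOpen I) : IsOpen (Dom I) :=
  (hI.preimage (continuous_apply 0)).inter (isOpen_ne.preimage (continuous_apply 1))

lemma isOpen_finDom (hI : IsOpen I) (N : ℕ) :
    IsOpen {y : Fin (N + 2) → ℝ | y 0 ∈ I ∧ y 1 ≠ 0} :=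
  (hI.preimage (continuous_apply 0)).inter (isOpen_ne.preimage (continuous_apply 1))

lemma truncate_mem (hz : z ∈ Dom I) (N : ℕ) :
    (fun i : Fin (N + 2) => z i) ∈ {y : Fin (N + 2) → ℝ | y 0 ∈ I ∧ y 1 ≠ 0} :=
  hz

namespace IsLocal

protected lemma congr (hg : IsLocal I g) (h : EqOn g' g (Dom I)) : IsLocal I g' :=
  let ⟨N, G, hG, hgG⟩ := hg
  ⟨N, G, hG, fun z hz => (h hz).trans (hgG z hz)⟩

lemma exists_forall_ge (hg : IsLocal I g) :
    ∃ N₀, ∀ N ≥ N₀, ∃ G : (Fin (N + 2) → ℝ) → ℝ,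
      ContDiffOn ℝ ∞ G {y | y 0 ∈ I ∧ y 1 ≠ 0} ∧ ∀ z ∈ Dom I, g z = G fun i => z i := by
  obtain ⟨N₀, G, hG, hgG⟩ := hg
  refine ⟨N₀, fun N hN => ⟨fun y => G fun i => y (i.castLE (by omega)), ?_, hgG⟩⟩
  exact hG.comp (contDiff_pi.2 fun i => contDiff_apply ..).contDiffOn fun y hy => hy

protected lemma comp {F : ℝ → ℝ} {S : Set ℝ} (hF : ContDiffOn ℝ ∞ F S) (hg : IsLocal I g)
    (hS : ∀ z ∈ Dom I, g z ∈ S) : IsLocal I fun z => F (g z) := by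
  obtain ⟨N, G, hG, hgG⟩ := hg
  refine ⟨N, fun y => F (G y), hF.comp hG fun y hy => ?_, fun z hz => congrArg F (hgG z hz)⟩
  let z : Jet := fun k => if h : k < N + 2 then y ⟨k, h⟩ else 0
  have hz : z ∈ Dom I := by simpa [z, Dom] using hy
  simpa [z, hgG z hz] using hS z hz

protected lemma coord (I : Set ℝ) (k : ℕ) : IsLocal I (coord k) :=
  ⟨k, fun y => y ⟨k, by omega⟩, (contDiff_apply ..).contDiffOn, fun _ _ => rfl⟩

protected lemma const (I : Set ℝ) (a : ℝ) : IsLocal I fun _ => a :=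
  ⟨0, fun _ => a, contDiffOn_const, fun _ _ => rfl⟩

lemma map₂ {F : ℝ × ℝ → ℝ} (hF : ContDiff ℝ ∞ F) (hf : IsLocal I f) (hg : IsLocal I g) :
    IsLocal I fun z => F (f z, g z) := by
  obtain ⟨M, hM⟩ := hf.exists_forall_ge
  obtain ⟨N, hN⟩ := hg.exists_forall_ge
  obtain ⟨A, hA, hfA⟩ := hM _ (le_max_left M N)
  obtain ⟨B, hB, hgB⟩ := hN _ (le_max_right M N)
  exact ⟨_, fun y => F (A y, B y), hF.comp_contDiffOn (hA.prodMk hB), fun z hz => by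
    simp only [hfA z hz, hgB z hz]⟩

protected lemma add (hf : IsLocal I f) (hg : IsLocal I g) : IsLocal I (f + g) :=
  map₂ contDiff_add hf hg

protected lemma mul (hf : IsLocal I f) (hg : IsLocal I g) : IsLocal I (f * g) :=
  map₂ contDiff_mul hf hg

protected lemma smul (a : ℝ) (hg : IsLocal I g) : IsLocal I (a • g) :=
  (IsLocal.const I a).mul hg

protected lemma sum {ι : Type*} {s : Finset ι} {g : ι → JetFun} (h : ∀ i ∈ s, IsLocal I (g i)) :
    IsLocal I fun z => ∑ i ∈ s, g i z := by
  classical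
  induction s using Finset.induction with
  | empty => simpa using IsLocal.const I 0
  | insert i s hi ih =>
    simp only [Finset.sum_insert hi]
    exact (h i (s.mem_insert_self i)).add (ih fun j hj => h j (Finset.mem_insert_of_mem hj))

lemma contDiffOn_comp {E : Type*} [NormedAddCommGroup E] [NormedSpace ℝ E] {S : Set E}
    {y : E → Jet} (hg : IsLocal I g) (hy : ∀ k, ContDiffOn ℝ ∞ (fun e => y e k) S)
    (hS : MapsTo y S (Dom I)) : ContDiffOn ℝ ∞ (fun e => g (y e)) S := by
  obtain ⟨N, G, hG, hgG⟩ := hg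
  refine (hG.comp (contDiffOn_pi.2 fun i : Fin (N + 2) => hy i) fun e he => hS he).congr ?_
  exact fun e he => hgG _ (hS he)

end IsLocal

/-! ### First variations -/

lemma finsum_eq_sum_range {F : ℕ → ℝ} {N : ℕ} (h : ∀ k ≥ N, F k = 0) :
    ∑ᶠ k, F k = ∑ k ∈ Finset.range N, F k :=
  finsum_eq_sum_of_support_subset _ fun k hk => by
    by_contra hkN
    exact hk (h k (by simpa using hkN))

/-- The first variation `∑ₖ hₖ ∂g/∂u^{(k)}` of `g` at a jet in the direction of the jet `h`. It
specializes to `totalD` and to `evol`. -/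
def variation (h : Jet) (g : JetFun) : JetFun :=
  fun z => ∑ᶠ k : ℕ, h k * pderiv k g z

/-- The jet `(w, ∂ₓ w, ∂ₓ² w, …)` of an infinitesimal deformation `u ↦ w`. -/
def prolong (w : JetFun) (z : Jet) : Jet :=
  fun k => (totalD^[k] w) z

lemma evol_eq_variation (w g : JetFun) (z : Jet) : evol w g z = variation (prolong w z) g z :=
  rfl

lemma hasDerivAt_update (z : Jet) (k j : ℕ) :
    HasDerivAt (fun t => Function.update z k t j) (Pi.single (M := fun _ => ℝ) k 1 j) (z k) := by
  rcases eq_or_ne j k with rfl | h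
  · simpa using hasDerivAt_id' _
  · simpa [h] using hasDerivAt_const _ _

/-- In terms of a smooth function `G` of finitely many variables representing `g`, the first
variation is the derivative of `G`. -/
lemma hasDerivAt_comp_of_eq_truncate (hI : IsOpen I) {N : ℕ} {G : (Fin (N + 2) → ℝ) → ℝ}
    (hG : ContDiffOn ℝ ∞ G {y | y 0 ∈ I ∧ y 1 ≠ 0}) (hgG : ∀ z ∈ Dom I, g z = G fun i => z i)
    {y : ℝ → Jet} {h : Jet} {t : ℝ} (hy : ∀ k, HasDerivAt (fun s => y s k) (h k) t)
    (hyt : y t ∈ Dom I) :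
    HasDerivAt (fun s => g (y s)) (fderiv ℝ G (fun i => y t i) fun i => h i) t := by
  have hcont : ContinuousAt y t := continuousAt_pi.2 fun k => (hy k).continuousAt
  have heq : (fun s => g (y s)) =ᶠ[𝓝 t] fun s => G fun i => y s i := by
    filter_upwards [hcont.preimage_mem_nhds ((isOpen_dom hI).mem_nhds hyt)] with s hs
      using hgG _ hs
  refine HasDerivAt.congr_of_eventuallyEq ?_ heq
  have hfd := ((hG.contDiffAt ((isOpen_finDom hI N).mem_nhds (truncate_mem hyt N))).differentiableAt
    (by simp)).hasFDerivAt
  exact hfd.comp_hasDerivAt t (hasDerivAt_pi.2 fun i : Fin (N + 2) => hy i)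

section Truncate

variable {N : ℕ} {G : (Fin (N + 2) → ℝ) → ℝ}

lemma pderiv_eq_fderiv (hI : IsOpen I) (hG : ContDiffOn ℝ ∞ G {y | y 0 ∈ I ∧ y 1 ≠ 0})
    (hgG : ∀ z ∈ Dom I, g z = G fun i => z i) (hz : z ∈ Dom I) (k : ℕ) :
    pderiv k g z = fderiv ℝ G (fun i => z i) fun i => Pi.single (M := fun _ => ℝ) k 1 i := by
  have h := hasDerivAt_comp_of_eq_truncate hI hG hgG (hasDerivAt_update z k)
    (by simpa using hz)
  simpa using! h.deriv

lemma pderiv_eq_zero_of_eq_truncate (hI : IsOpen I)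
    (hG : ContDiffOn ℝ ∞ G {y | y 0 ∈ I ∧ y 1 ≠ 0}) (hgG : ∀ z ∈ Dom I, g z = G fun i => z i)
    {k : ℕ} (hk : N + 2 ≤ k) (hz : z ∈ Dom I) : pderiv k g z = 0 := by
  rw [pderiv_eq_fderiv hI hG hgG hz]
  convert map_zero (fderiv ℝ G fun i => z i) using 2
  funext i
  simp [(i.2.trans_le hk).ne]

lemma variation_eq_fderiv (hI : IsOpen I) (hG : ContDiffOn ℝ ∞ G {y | y 0 ∈ I ∧ y 1 ≠ 0})
    (hgG : ∀ z ∈ Dom I, g z = G fun i => z i) (hz : z ∈ Dom I) (h : Jet) :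
    variation h g z = fderiv ℝ G (fun i => z i) fun i => h i := by
  rw [variation, finsum_eq_sum_range (N := N + 2) fun k hk => by
    rw [pderiv_eq_zero_of_eq_truncate hI hG hgG hk hz, mul_zero], Finset.sum_range]
  refine Eq.trans ?_ (LinearMap.pi_apply_eq_sum_univ (fderiv ℝ G fun i => z i).toLinearMap _).symm
  refine Finset.sum_congr rfl fun i _ => ?_
  rw [pderiv_eq_fderiv hI hG hgG hz, smul_eq_mul, ContinuousLinearMap.coe_coe]
  congr 2
  funext j
  simp [Pi.single_apply, Fin.ext_iff, eq_comm]

end Truncate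

namespace IsLocal

protected lemma pderiv (hI : IsOpen I) (hg : IsLocal I g) (k : ℕ) : IsLocal I (pderiv k g) := by
  obtain ⟨N, G, hG, hgG⟩ := hg
  exact ⟨N, fun y => fderiv ℝ G y fun i => Pi.single (M := fun _ => ℝ) k 1 i,
    contDiffOn_dirDeriv (isOpen_finDom hI N) hG _, fun z hz => pderiv_eq_fderiv hI hG hgG hz k⟩

lemma exists_pderiv_eq_zero (hI : IsOpen I) (hg : IsLocal I g) :
    ∃ N, ∀ k ≥ N, EqOn (pderiv k g) 0 (Dom I) := by
  obtain ⟨N, G, hG, hgG⟩ := hg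
  exact ⟨N + 2, fun k hk z hz => pderiv_eq_zero_of_eq_truncate hI hG hgG hk hz⟩

theorem hasDerivAt_comp (hI : IsOpen I) (hg : IsLocal I g) {y : ℝ → Jet} {h : Jet} {t : ℝ}
    (hy : ∀ k, HasDerivAt (fun s => y s k) (h k) t) (hyt : y t ∈ Dom I) :
    HasDerivAt (fun s => g (y s)) (variation h g (y t)) t := by
  obtain ⟨N, G, hG, hgG⟩ := hg
  rw [variation_eq_fderiv hI hG hgG hyt]
  exact hasDerivAt_comp_of_eq_truncate hI hG hgG hy hyt

lemma exists_variation_eq_sum (hI : IsOpen I) (hg : IsLocal I g) :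
    ∃ N, ∀ z ∈ Dom I, ∀ h, variation h g z
      = ∑ k ∈ Finset.range N, h k * pderiv k g z := by
  obtain ⟨N, hN⟩ := hg.exists_pderiv_eq_zero hI
  exact ⟨N, fun z hz h => finsum_eq_sum_range fun k hk => by simp [hN k hk hz]⟩

protected lemma variation (hI : IsOpen I) (hg : IsLocal I g) {h : Jet → Jet}
    (hh : ∀ k, IsLocal I fun z => h z k) : IsLocal I fun z => variation (h z) g z := by
  obtain ⟨N, hN⟩ := hg.exists_variation_eq_sum hI
  exact (IsLocal.sum (s := Finset.range N) fun k _ => (hh k).mul (hg.pderiv hI k)).congr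
    fun z hz => hN z hz (h z)

protected lemma totalD (hI : IsOpen I) (hg : IsLocal I g) : IsLocal I (totalD g) :=
  hg.variation hI fun k => IsLocal.coord I (k + 1)

lemma iterate_totalD (hI : IsOpen I) (hg : IsLocal I g) (k : ℕ) :
    IsLocal I (totalD^[k] g) := by
  induction k with
  | zero => exact hg
  | succ k ih =>
    rw [Function.iterate_succ_apply']
    exact ih.totalD hI

protected lemma evol (hI : IsOpen I) {w : JetFun} (hw : IsLocal I w) (hg : IsLocal I g) :
    IsLocal I (evol w g) :=
  hg.variation hI fun k => hw.iterate_totalD hI k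

end IsLocal

/-! ### Rules of differentiation -/

lemma pderiv_congr (hI : IsOpen I) (h : EqOn g g' (Dom I)) (k : ℕ) :
    EqOn (pderiv k g) (pderiv k g') (Dom I) := fun z hz => by
  have hcont : ContinuousAt (Function.update z k) (z k) :=
    (continuous_const.update k continuous_id).continuousAt
  refine EventuallyEq.deriv_eq ?_
  filter_upwards [hcont.preimage_mem_nhds ((isOpen_dom hI).mem_nhds (by simpa using hz))] with t ht
    using h ht

lemma variation_congr (hI : IsOpen I) (hg : EqOn g g' (Dom I)) (h : Jet) :
    EqOn (variation h g) (variation h g') (Dom I) := fun z hz =>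
  finsum_congr fun k => by rw [pderiv_congr hI hg k hz]

lemma totalD_congr (hI : IsOpen I) (hg : EqOn g g' (Dom I)) :
    EqOn (totalD g) (totalD g') (Dom I) := fun _ hz =>
  variation_congr hI hg _ hz

lemma iterate_totalD_congr (hI : IsOpen I) (hg : EqOn g g' (Dom I)) (k : ℕ) :
    EqOn (totalD^[k] g) (totalD^[k] g') (Dom I) := by
  induction k with
  | zero => exact hg
  | succ k ih =>
    simp only [Function.iterate_succ_apply']
    exact totalD_congr hI ih

lemma evol_congr (hI : IsOpen I) {w w' : JetFun} (hw : EqOn w w' (Dom I))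
    (hg : EqOn g g' (Dom I)) : EqOn (evol w g) (evol w' g') (Dom I) := fun z hz =>
  finsum_congr fun k => by rw [pderiv_congr hI hg k hz, iterate_totalD_congr hI hw k hz]

lemma pderiv_zero (k : ℕ) : pderiv k 0 = 0 := by
  funext z
  exact deriv_const _ _

lemma totalD_zero : totalD 0 = 0 := by
  funext z
  simp [totalD, pderiv_zero]

lemma iterate_totalD_zero (k : ℕ) : totalD^[k] 0 = 0 :=
  Function.iterate_fixed totalD_zero k

lemma IsLocal.exists_euler_eq_sum (hI : IsOpen I) (hg : IsLocal I g) :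
    ∃ N, EqOn (euler g)
      (fun z => ∑ k ∈ Finset.range N, (-1 : ℝ) ^ k * (totalD^[k] (pderiv k g)) z) (Dom I) := by
  obtain ⟨N, hN⟩ := hg.exists_pderiv_eq_zero hI
  refine ⟨N, fun z hz => finsum_eq_sum_range fun k hk => ?_⟩
  simp [iterate_totalD_congr hI (hN k hk) k hz, iterate_totalD_zero]

protected lemma IsLocal.euler (hI : IsOpen I) (hg : IsLocal I g) : IsLocal I (euler g) := by
  obtain ⟨N, hN⟩ := hg.exists_euler_eq_sum hI
  exact (IsLocal.sum (s := Finset.range N) fun k _ =>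
    ((hg.pderiv hI k).iterate_totalD hI k).smul ((-1) ^ k)).congr hN

lemma IsLocal.hasDerivAt_line (hI : IsOpen I) (hg : IsLocal I g) (hz : z ∈ Dom I) (h : Jet) :
    HasDerivAt (fun t : ℝ => g (z + t • h)) (variation h g z) 0 := by
  have hline (k : ℕ) : HasDerivAt (fun t : ℝ => (z + t • h) k) (h k) 0 :=
    hasDerivAt_add_smul (z k) (h k) 0
  simpa using hg.hasDerivAt_comp hI hline (by simpa using hz)

section Rules

variable (h : Jet)

lemma variation_add (hI : IsOpen I) (hf : IsLocal I f) (hg : IsLocal I g) (hz : z ∈ Dom I) :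
    variation h (f + g) z = variation h f z + variation h g z :=
  ((hf.add hg).hasDerivAt_line hI hz h).unique
    ((hf.hasDerivAt_line hI hz h).add (hg.hasDerivAt_line hI hz h))

lemma variation_mul (hI : IsOpen I) (hf : IsLocal I f) (hg : IsLocal I g) (hz : z ∈ Dom I) :
    variation h (f * g) z = variation h f z * g z + f z * variation h g z := by
  simpa using ((hf.mul hg).hasDerivAt_line hI hz h).unique
    ((hf.hasDerivAt_line hI hz h).mul (hg.hasDerivAt_line hI hz h))

lemma variation_comp (hI : IsOpen I) (hg : IsLocal I g) {F : ℝ → ℝ} {F' : ℝ} (hz : z ∈ Dom I)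
    (hFg : IsLocal I fun z => F (g z)) (hF : HasDerivAt F F' (g z)) :
    variation h (fun z => F (g z)) z = F' * variation h g z := by
  refine (hFg.hasDerivAt_line hI hz h).unique (HasDerivAt.comp (h₂ := F) 0 ?_ ?_)
  · simpa using hF
  · exact hg.hasDerivAt_line hI hz h

lemma variation_const (a : ℝ) (z : Jet) : variation h (fun _ => a) z = 0 := by
  simp [variation, pderiv]

lemma variation_smul (a : ℝ) (g : JetFun) (z : Jet) :
    variation h (a • g) z = a * variation h g z := by
  have hpderiv (k : ℕ) : pderiv k (a • g) z = a • pderiv k g z :=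
    deriv_const_mul_field (v := fun t => g (Function.update z k t)) a
  simp only [variation, hpderiv, mul_smul_comm, ← smul_eq_mul (a := a), smul_finsum]

lemma variation_coord (k : ℕ) (z : Jet) : variation h (coord k) z = h k := by
  rw [variation, finsum_eq_single _ k fun j hj => by simp [pderiv, coord, hj.symm]]
  simp [pderiv, coord]

end Rules

end Local

/-! ### Families depending on a parameter -/

section Parameter

variable {E : Type*} [NormedAddCommGroup E] [NormedSpace ℝ E] {U : Set (ℝ × E)} {Ω : Set E}
  {Φ : ℝ × E → ℝ}

lemma hasDerivAt_prodMk_left (q : E) (t : ℝ) :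
    HasDerivAt (fun ε : ℝ => (ε, q)) ((1 : ℝ), (0 : E)) t :=
  (hasDerivAt_id t).prodMk (hasDerivAt_const t q)

lemma isBigO_pow_iff_iterate_dirDeriv (hU : IsOpen U) (hΦ : ContDiffOn ℝ ∞ Φ U) {q : E}
    (hq : ((0 : ℝ), q) ∈ U) (n : ℕ) :
    (fun ε => Φ (ε, q)) =O[𝓝 0] (fun ε : ℝ => ε ^ n) ↔
      ∀ k < n, (dirDeriv ((1 : ℝ), (0 : E)))^[k] Φ (0, q) = 0 := by
  have hslice : Continuous fun ε : ℝ => (ε, q) := by fun_prop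
  have hsmooth : ContDiffOn ℝ ∞ (fun ε => Φ (ε, q)) ((fun ε => (ε, q)) ⁻¹' U) :=
    hΦ.comp (by fun_prop) fun ε hε => hε
  rw [isBigO_pow_iff (hU.preimage hslice) hq hsmooth]
  refine forall₂_congr fun k _ => ?_
  rw [← iteratedDeriv_comp_eq_dirDeriv hU hΦ (hasDerivAt_prodMk_left q) k hq]

/-- By the vanishing of the Taylor coefficients in `ε` this reduces to the commutation of
derivatives. -/
lemma isBigO_dirDeriv (hU : IsOpen U) (hΦ : ContDiffOn ℝ ∞ Φ U) (hΩ : IsOpen Ω)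
    (hΩU : ∀ q ∈ Ω, ((0 : ℝ), q) ∈ U) {n : ℕ}
    (h : ∀ q ∈ Ω, (fun ε => Φ (ε, q)) =O[𝓝 0] fun ε : ℝ => ε ^ n) (v : E) :
    ∀ q ∈ Ω, (fun ε => dirDeriv ((0 : ℝ), v) Φ (ε, q)) =O[𝓝 0] fun ε : ℝ => ε ^ n := by
  intro q hq
  refine (isBigO_pow_iff_iterate_dirDeriv hU (contDiffOn_dirDeriv hU hΦ _) (hΩU q hq) n).2
    fun k hk => ?_
  rw [iterate_dirDeriv_comm hU hΦ _ _ k (hΩU q hq)]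
  have hline : HasDerivAt (fun t : ℝ => ((0 : ℝ), q + t • v)) ((0 : ℝ), v) 0 :=
    (hasDerivAt_const _ _).prodMk (hasDerivAt_add_smul q v 0)
  have hderiv := hasDerivAt_comp_dirDeriv hU (contDiffOn_iterate_dirDeriv hU hΦ (1, 0) k)
    (by simpa using hΩU q hq) hline
  have hmem : ∀ᶠ t : ℝ in 𝓝 0, q + t • v ∈ Ω :=
    (hasDerivAt_add_smul q v 0).continuousAt.preimage_mem_nhds (by simpa using hΩ.mem_nhds hq)
  have hzero : (fun t : ℝ => (dirDeriv ((1 : ℝ), (0 : E)))^[k] Φ (0, q + t • v))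
      =ᶠ[𝓝 0] fun _ => 0 := by
    filter_upwards [hmem] with t ht
    exact (isBigO_pow_iff_iterate_dirDeriv hU hΦ (hΩU _ ht) n).1 (h _ ht) k hk
  simpa using hderiv.unique ((hasDerivAt_const (0 : ℝ) (0 : ℝ)).congr_of_eventuallyEq hzero)

lemma isBigO_iterate_dirDeriv (hU : IsOpen U) (hΦ : ContDiffOn ℝ ∞ Φ U) (hΩ : IsOpen Ω)
    (hΩU : ∀ q ∈ Ω, ((0 : ℝ), q) ∈ U) {n : ℕ}
    (h : ∀ q ∈ Ω, (fun ε => Φ (ε, q)) =O[𝓝 0] fun ε : ℝ => ε ^ n) (v : E) (k : ℕ) :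
    ∀ q ∈ Ω, (fun ε => (dirDeriv ((0 : ℝ), v))^[k] Φ (ε, q)) =O[𝓝 0] fun ε : ℝ => ε ^ n := by
  induction k with
  | zero => exact h
  | succ k ih =>
    simp only [Function.iterate_succ_apply']
    exact isBigO_dirDeriv hU (contDiffOn_iterate_dirDeriv hU hΦ _ k) hΩ hΩU ih v

end Parameter

section Local

variable {I : Set ℝ} {f g : JetFun} {z : Jet}

/-! ### Jets of functions -/

lemma hasDerivAt_comp_jet (hI : IsOpen I) (hg : IsLocal I g) {w : ℝ → ℝ} {A : Set ℝ}
    (hA : IsOpen A) (hw : ContDiffOn ℝ ∞ w A) {x : ℝ} (hx : x ∈ A) (hD : jet w x ∈ Dom I) :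
    HasDerivAt (fun y => g (jet w y)) (totalD g (jet w x)) x :=
  hg.hasDerivAt_comp hI (fun k => hasDerivAt_iteratedDeriv hA hw k hx) hD

lemma iteratedDeriv_comp_jet (hI : IsOpen I) (hg : IsLocal I g) {w : ℝ → ℝ} {A : Set ℝ}
    (hA : IsOpen A) (hw : ContDiffOn ℝ ∞ w A) (hD : ∀ x ∈ A, jet w x ∈ Dom I) (k : ℕ) {x : ℝ}
    (hx : x ∈ A) :
    iteratedDeriv k (fun y => g (jet w y)) x = (totalD^[k] g) (jet w x) := by
  induction k generalizing x with
  | zero => simp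
  | succ k ih =>
    have h : iteratedDeriv k (fun y => g (jet w y)) =ᶠ[𝓝 x] fun y => (totalD^[k] g) (jet w y) := by
      filter_upwards [hA.mem_nhds hx] with y hy using ih hy
    rw [iteratedDeriv_succ, h.deriv_eq, Function.iterate_succ_apply',
      (hasDerivAt_comp_jet hI (hg.iterate_totalD hI k) hA hw hx (hD x hx)).deriv]

lemma contDiffOn_comp_jet (hg : IsLocal I g) {w : ℝ → ℝ} {A : Set ℝ} (hA : IsOpen A)
    (hw : ContDiffOn ℝ ∞ w A) (hD : ∀ x ∈ A, jet w x ∈ Dom I) :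
    ContDiffOn ℝ ∞ (fun y => g (jet w y)) A :=
  hg.contDiffOn_comp (fun k => contDiffOn_iteratedDeriv hA hw k) hD

/-! ### Taylor expansion of a local function under a shift of the jet -/

/-- The second variation `∑ⱼₖ hⱼ hₖ ∂²g/∂u^{(j)}∂u^{(k)}`. -/
def secondVariation (h : Jet) (g : JetFun) : JetFun :=
  fun z => ∑ᶠ k : ℕ, h k * variation h (pderiv k g) z

/-- The curve of jets `z + η h₁ + η² h₂`. -/
def parabola (z h₁ h₂ : Jet) (η : ℝ) : Jet :=
  fun k => z k + η * h₁ k + η ^ 2 * h₂ k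

lemma parabola_zero (z h₁ h₂ : Jet) : parabola z h₁ h₂ 0 = z := by
  funext k
  simp [parabola]

lemma hasDerivAt_parabola (z h₁ h₂ : Jet) (η : ℝ) (k : ℕ) :
    HasDerivAt (fun η => parabola z h₁ h₂ η k) (h₁ k + 2 * η * h₂ k) η := by
  simpa [parabola] using! (((hasDerivAt_id' η).mul_const (h₁ k)).const_add (z k)).fun_add
    ((hasDerivAt_pow 2 η).mul_const (h₂ k))

lemma continuousAt_parabola (z h₁ h₂ : Jet) (η : ℝ) : ContinuousAt (parabola z h₁ h₂) η :=
  continuousAt_pi.2 fun k => (hasDerivAt_parabola z h₁ h₂ η k).continuousAt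

lemma eventually_parabola_mem_dom (hI : IsOpen I) (hz : z ∈ Dom I) (h₁ h₂ : Jet) :
    ∀ᶠ η in 𝓝 0, parabola z h₁ h₂ η ∈ Dom I :=
  (continuousAt_parabola z h₁ h₂ 0).preimage_mem_nhds
    ((isOpen_dom hI).mem_nhds (by rwa [parabola_zero]))

lemma hasDerivAt_comp_parabola (hI : IsOpen I) (hg : IsLocal I g) {h₁ h₂ : Jet} {η : ℝ}
    (hz : parabola z h₁ h₂ η ∈ Dom I) :
    HasDerivAt (fun η => g (parabola z h₁ h₂ η))
      (variation (fun k => h₁ k + 2 * η * h₂ k) g (parabola z h₁ h₂ η)) η :=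
  hg.hasDerivAt_comp hI (hasDerivAt_parabola z h₁ h₂ η) hz

lemma hasDerivAt_comp_parabola_zero (hI : IsOpen I) (hg : IsLocal I g) (hz : z ∈ Dom I)
    (h₁ h₂ : Jet) :
    HasDerivAt (fun η => g (parabola z h₁ h₂ η)) (variation h₁ g z) 0 := by
  have h := hasDerivAt_comp_parabola hI hg (h₁ := h₁) (h₂ := h₂) (by rwa [parabola_zero])
  simpa [parabola_zero] using h

lemma hasDerivAt_variation_parabola (hI : IsOpen I) (hg : IsLocal I g) (hz : z ∈ Dom I)
    (h₁ h₂ : Jet) :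
    HasDerivAt (fun η => variation (fun k => h₁ k + 2 * η * h₂ k) g (parabola z h₁ h₂ η))
      (2 * variation h₂ g z + secondVariation h₁ g z) 0 := by
  obtain ⟨N, hN⟩ := hg.exists_pderiv_eq_zero hI
  have hvar (h : Jet) {y : Jet} (hy : y ∈ Dom I) :
      variation h g y = ∑ k ∈ Finset.range N, h k * pderiv k g y :=
    finsum_eq_sum_range fun k hk => by simp [hN k hk hy]
  have hsecond : secondVariation h₁ g z
      = ∑ k ∈ Finset.range N, h₁ k * variation h₁ (pderiv k g) z :=
    finsum_eq_sum_range fun k hk => by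
      rw [variation_congr hI (hN k hk) h₁ hz]
      simp [variation, pderiv_zero]
  have hterm (k : ℕ) : HasDerivAt
      (fun η => (h₁ k + 2 * η * h₂ k) * pderiv k g (parabola z h₁ h₂ η))
      (2 * (h₂ k * pderiv k g z) + h₁ k * variation h₁ (pderiv k g) z) 0 := by
    have hcoef : HasDerivAt (fun η : ℝ => h₁ k + 2 * η * h₂ k) (2 * h₂ k) 0 := by
      simpa using (((hasDerivAt_id' (0 : ℝ)).const_mul 2).mul_const (h₂ k)).const_add (h₁ k)
    simpa [parabola_zero, mul_assoc] using
      hcoef.fun_mul (hasDerivAt_comp_parabola_zero hI (hg.pderiv hI k) hz h₁ h₂)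
  rw [hvar h₂ hz, hsecond, Finset.mul_sum, ← Finset.sum_add_distrib]
  refine (HasDerivAt.fun_sum fun k _ => hterm k).congr_of_eventuallyEq ?_
  filter_upwards [eventually_parabola_mem_dom hI hz h₁ h₂] with η hη using hvar _ hη

/-- The jet of `u + η T₁ + η² T₂`, where `T₁` and `T₂` are evaluated on the jet `z` of `u`. -/
def shift (T₁ T₂ : JetFun) (η : ℝ) (z : Jet) : Jet :=
  parabola z (prolong T₁ z) (prolong T₂ z) η

/-- For `k ≤ 2`, the coefficient of `ηᵏ` in the expansion of `g (shift T₁ T₂ η z)`; higher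
coefficients never occur modulo `ε⁶`, where `η = ε²`. -/
def shiftCoeff (T₁ T₂ g : JetFun) : ℕ → JetFun
  | 0 => g
  | 1 => evol T₁ g
  | 2 => fun z => evol T₂ g z + 1 / 2 * secondVariation (prolong T₁ z) g z
  | _ => 0

lemma iteratedDeriv_comp_shift (hI : IsOpen I) (hg : IsLocal I g) (hz : z ∈ Dom I)
    (T₁ T₂ : JetFun) {k : ℕ} (hk : k < 3) :
    iteratedDeriv k (fun η => g (shift T₁ T₂ η z)) 0 = k ! * shiftCoeff T₁ T₂ g k z := by
  interval_cases k
  · simp [shift, parabola_zero, shiftCoeff]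
  · rw [iteratedDeriv_one]
    simpa [shiftCoeff] using! (hasDerivAt_comp_parabola_zero hI hg hz _ _).deriv
  · have hderiv : deriv (fun η => g (shift T₁ T₂ η z)) =ᶠ[𝓝 0] _ :=
      (eventually_parabola_mem_dom hI hz _ _).mono fun η hη =>
        (hasDerivAt_comp_parabola hI hg hη).deriv
    rw [iteratedDeriv_succ, iteratedDeriv_one, hderiv.deriv_eq,
      (hasDerivAt_variation_parabola hI hg hz _ _).deriv]
    simp only [shiftCoeff, evol_eq_variation, Nat.factorial_two, Nat.cast_ofNat]
    ring

theorem isBigO_comp_shift_sub (hI : IsOpen I) (hg : IsLocal I g) {T₁ T₂ : JetFun}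
    (hT₁ : IsLocal I T₁) (hT₂ : IsLocal I T₂) {U : Set ℝ} (hU : IsOpen U) (h0 : (0 : ℝ) ∈ U)
    {y : ℝ → Jet} (hy : ∀ k, ContDiffOn ℝ ∞ (fun ε => y ε k) U) (hD : MapsTo y U (Dom I))
    {n : ℕ} (hn : n ≤ 3) :
    (fun ε => g (shift T₁ T₂ (ε ^ 2) (y ε))
      - ∑ k ∈ Finset.range n, ε ^ (2 * k) * shiftCoeff T₁ T₂ g k (y ε))
      =O[𝓝 0] fun ε => ε ^ (2 * n) := by
  let Y : ℝ × ℝ → Jet := fun q => shift T₁ T₂ q.2 (y q.1)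
  let O := (Prod.fst ⁻¹' U) ∩ Y ⁻¹' Dom I
  have hprolong {T : JetFun} (hT : IsLocal I T) (k : ℕ) :
      ContDiffOn ℝ ∞ (fun q : ℝ × ℝ => prolong T (y q.1) k) (Prod.fst ⁻¹' U) :=
    ((hT.iterate_totalD hI k).contDiffOn_comp hy hD).comp contDiffOn_fst fun q hq => hq
  have hY (k : ℕ) : ContDiffOn ℝ ∞ (fun q => Y q k) (Prod.fst ⁻¹' U) :=
    (((hy k).comp contDiffOn_fst fun q hq => hq).add
      (contDiffOn_snd.mul (hprolong hT₁ k))).add ((contDiffOn_snd.pow 2).mul (hprolong hT₂ k))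
  have hO : IsOpen O := (continuousOn_pi.2 fun k => (hY k).continuousOn).isOpen_inter_preimage
    (hU.preimage continuous_fst) (isOpen_dom hI)
  have hmem {ε : ℝ} (hε : ε ∈ U) : (ε, (0 : ℝ)) ∈ O :=
    ⟨hε, by simpa [Y, shift, parabola_zero] using hD hε⟩
  have hsmooth : ContDiffOn ℝ ∞ (fun q => g (Y q)) O :=
    hg.contDiffOn_comp (fun k => (hY k).mono inter_subset_left) fun q hq => hq.2
  have hcoeff {ε : ℝ} (hε : ε ∈ U) {k : ℕ} (hk : k < 3) :
      (dirDeriv ((0 : ℝ), (1 : ℝ)))^[k] (fun q => g (Y q)) (ε, 0)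
        = k ! * shiftCoeff T₁ T₂ g k (y ε) :=
    (iteratedDeriv_comp_eq_dirDeriv hO hsmooth
      (fun t => (hasDerivAt_const t ε).prodMk (hasDerivAt_id t)) k (hmem hε)).symm.trans
      (iteratedDeriv_comp_shift hI hg (hD hε) T₁ T₂ hk)
  have hlim : Tendsto (fun ε : ℝ => ((ε, (0 : ℝ)), ε ^ 2)) (𝓝 0) (𝓝 ((0, 0), 0)) :=
    Continuous.tendsto' (by fun_prop) _ _ (by simp)
  refine ((isBigO_sub_taylor hO hsmooth (hmem h0) (0, 1) n).comp_tendsto hlim).congr' ?_ ?_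
  · filter_upwards [hU.mem_nhds h0] with ε hε
    simp only [Function.comp_apply, Prod.smul_mk, smul_eq_mul, mul_zero, mul_one, Prod.mk_add_mk,
      add_zero, zero_add, Y]
    congr 1
    refine Finset.sum_congr rfl fun k hk => ?_
    rw [hcoeff hε ((Finset.mem_range.1 hk).trans_le hn), pow_mul]
    field_simp
  · exact Eventually.of_forall fun ε => (pow_mul ε 2 n).symm

end Local

/-! ### Composition of even expansions -/

section Even

open PowerSeries (coeff)

/-- Modulo `ε⁶` the series `F` is even in `ε`, with coefficients which are local on `Dom I`. -/
structure IsEvenLocal (I : Set ℝ) (F : EpsFun) : Prop where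
  coeff_odd : ∀ i < 3, coeff (2 * i + 1) F = 0
  isLocal : ∀ i < 3, IsLocal I (coeff (2 * i) F)

/-- A substitution `u ↦ u + O(ε²)` which modulo `ε⁶` is even in `ε`. -/
structure IsSubstitution (I : Set ℝ) (V : EpsFun) : Prop extends IsEvenLocal I V where
  coeff_zero : coeff 0 V = coord 0

/-- The coefficient of `ε^{2k}`, `k ≤ 2`, in the composition of `F` with the substitution `V`. -/
def compCoeff (V F : EpsFun) (k : ℕ) : JetFun :=
  fun z => ∑ i ∈ Finset.range (k + 1),
    shiftCoeff (coeff 2 V) (coeff 4 V) (coeff (2 * i) F) (k - i) z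

variable {I : Set ℝ} {F V W : EpsFun} {z : Jet}

lemma IsEvenLocal.eval6_eq (hF : IsEvenLocal I F) (ε : ℝ) (z : Jet) :
    eval6 F ε z = ∑ i ∈ Finset.range 3, ε ^ (2 * i) * coeff (2 * i) F z := by
  have h1 : coeff 1 F = 0 := hF.coeff_odd 0 (by norm_num)
  have h3 : coeff 3 F = 0 := hF.coeff_odd 1 (by norm_num)
  have h5 : coeff 5 F = 0 := hF.coeff_odd 2 (by norm_num)
  simp [eval6, Finset.sum_range_succ, h1, h3, h5]

lemma IsSubstitution.isLocal_two (hV : IsSubstitution I V) : IsLocal I (coeff 2 V) :=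
  hV.isLocal 1 (by norm_num)

lemma IsSubstitution.isLocal_four (hV : IsSubstitution I V) : IsLocal I (coeff 4 V) :=
  hV.isLocal 2 (by norm_num)

lemma IsSubstitution.eval6_eq (hV : IsSubstitution I V) (ε : ℝ) (z : Jet) :
    eval6 V ε z = z 0 + ε ^ 2 * coeff 2 V z + ε ^ 4 * coeff 4 V z := by
  simp [hV.toIsEvenLocal.eval6_eq, Finset.sum_range_succ, hV.coeff_zero, coord,
    -PowerSeries.coeff_zero_eq_constantCoeff]

lemma IsSubstitution.jet_eval6 (hI : IsOpen I) (hV : IsSubstitution I V) {w : ℝ → ℝ} {A : Set ℝ}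
    (hA : IsOpen A) (hw : ContDiffOn ℝ ∞ w A) (hD : ∀ x ∈ A, jet w x ∈ Dom I) (ε : ℝ) {x : ℝ}
    (hx : x ∈ A) :
    jet (fun y => eval6 V ε (jet w y)) x = shift (coeff 2 V) (coeff 4 V) (ε ^ 2) (jet w x) := by
  funext k
  have hsmooth {T : JetFun} (hT : IsLocal I T) : ContDiffAt ℝ k (fun y => T (jet w y)) x :=
    contDiffAt_infty.1 ((contDiffOn_comp_jet hT hA hw hD).contDiffAt (hA.mem_nhds hx)) k
  have hwk : ContDiffAt ℝ k w x := contDiffAt_infty.1 (hw.contDiffAt (hA.mem_nhds hx)) k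
  have hjet (y : ℝ) : jet w y 0 = w y := by simp [jet]
  have h2 := hsmooth hV.isLocal_two
  have h4 := hsmooth hV.isLocal_four
  simp only [hV.eval6_eq, hjet]
  change iteratedDeriv k _ x = _
  rw [iteratedDeriv_fun_add (hwk.add (contDiffAt_const.mul h2)) (contDiffAt_const.mul h4),
    iteratedDeriv_fun_add hwk (contDiffAt_const.mul h2), iteratedDeriv_const_mul_field,
    iteratedDeriv_const_mul_field,
    iteratedDeriv_comp_jet hI hV.isLocal_two hA hw hD k hx,
    iteratedDeriv_comp_jet hI hV.isLocal_four hA hw hD k hx]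
  simp [shift, parabola, prolong, jet, ← pow_mul]

theorem isBigO_eval6_shift_sub (hI : IsOpen I) (hF : IsEvenLocal I F) (hV : IsSubstitution I V)
    {U : Set ℝ} (hU : IsOpen U) (h0 : (0 : ℝ) ∈ U) {y : ℝ → Jet}
    (hy : ∀ k, ContDiffOn ℝ ∞ (fun ε => y ε k) U) (hD : MapsTo y U (Dom I)) :
    (fun ε => eval6 F ε (shift (coeff 2 V) (coeff 4 V) (ε ^ 2) (y ε))
      - ∑ k ∈ Finset.range 3, ε ^ (2 * k) * compCoeff V F k (y ε)) =O[𝓝 0] fun ε => ε ^ 6 := by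
  have hterm (i : ℕ) (hi : i ∈ Finset.range 3) :
      (fun ε => ε ^ (2 * i) * (coeff (2 * i) F (shift (coeff 2 V) (coeff 4 V) (ε ^ 2) (y ε))
        - ∑ k ∈ Finset.range (3 - i), ε ^ (2 * k)
          * shiftCoeff (coeff 2 V) (coeff 4 V) (coeff (2 * i) F) k (y ε)))
        =O[𝓝 0] fun ε => ε ^ 6 := by
    have hi' := Finset.mem_range.1 hi
    refine ((isBigO_refl _ _).mul (isBigO_comp_shift_sub hI (hF.isLocal i hi') hV.isLocal_two
      hV.isLocal_four hU h0 hy hD (Nat.sub_le 3 i))).congr_right fun ε => ?_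
    rw [← pow_add]
    congr 1
    omega
  refine (IsBigO.sum hterm).congr_left fun ε => ?_
  simp only [hF.eval6_eq, compCoeff, Finset.sum_range_succ, Finset.sum_range_zero]
  norm_num
  ring

lemma evol_coord_zero (w : JetFun) : evol w (coord 0) = w := by
  funext z
  rw [evol_eq_variation, variation_coord]
  rfl

theorem eval6_eval6_sub_isBigO (hI : IsOpen I) (hV : IsSubstitution I V) (hW : IsSubstitution I W)
    (hcomp : ∀ k < 2, EqOn (compCoeff V W (k + 1)) 0 (Dom I)) {w : ℝ → ℝ} {A : Set ℝ}
    (hA : IsOpen A) (hw : ContDiffOn ℝ ∞ w A) (hD : ∀ x ∈ A, jet w x ∈ Dom I) {x : ℝ}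
    (hx : x ∈ A) :
    (fun ε => eval6 W ε (jet (fun y => eval6 V ε (jet w y)) x) - w x)
      =O[𝓝 0] fun ε : ℝ => ε ^ 6 := by
  have h1 : compCoeff V W 1 (jet w x) = 0 := hcomp 0 (by norm_num) (hD x hx)
  have h2 : compCoeff V W 2 (jet w x) = 0 := hcomp 1 (by norm_num) (hD x hx)
  have h0 : compCoeff V W 0 (jet w x) = w x := by
    simp [compCoeff, shiftCoeff, hW.coeff_zero, coord, jet,
      -PowerSeries.coeff_zero_eq_constantCoeff]
  refine (isBigO_eval6_shift_sub hI hW.toIsEvenLocal hV isOpen_univ (mem_univ 0)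
    (y := fun _ => jet w x) (fun _ => contDiffOn_const) fun _ _ => hD x hx).congr_left fun ε => ?_
  rw [hV.jet_eval6 hI hA hw hD ε hx]
  simp [Finset.sum_range_succ, h0, h1, h2]

end Even

/-! ### Transport of approximate solutions -/

open PowerSeries (coeff)

/-- `w_s + B(w, w_x, w_xx, …; ε) = O(ε⁶)` at all points of `Ω`. This covers both
`SolvesHamiltonian` and `SolvesUnperturbed`. -/
def SolvesEvolution (B : EpsFun) (Ω : Set (ℝ × ℝ)) (w : ℝ → ℝ → ℝ → ℝ) : Prop :=
  ∀ x s, (x, s) ∈ Ω →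
    (fun ε => deriv (fun σ => w ε x σ) s + eval6 B ε (jet (fun y => w ε y s) x))
      =O[𝓝 0] fun ε : ℝ => ε ^ 6

/-- The jet in `x` of a family `w = w(ε, x, s)` at the point `r = (ε, x, s)`. -/
def jetAt (w : ℝ → ℝ → ℝ → ℝ) (r : ℝ × ℝ × ℝ) : Jet :=
  jet (fun y => w r.1 y r.2.2) r.2.1

/-- The defect `w_s + B(w, w_x, w_xx, …; ε)`, as a function of `(ε, x, s)`. -/
def residue (B : EpsFun) (w : ℝ → ℝ → ℝ → ℝ) : ℝ × ℝ × ℝ → ℝ :=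
  fun r => dirDeriv (0, 0, 1) (fun r => w r.1 r.2.1 r.2.2) r + eval6 B r.1 (jetAt w r)

/-- The coefficient of `ε^{2k}`, `k ≤ 2`, in the derivative of `V` along the flow `u_s = B`. -/
def flowCoeff (B V : EpsFun) (k : ℕ) : JetFun :=
  fun z => ∑ i ∈ Finset.range (k + 1), evol (coeff (2 * (k - i)) B) (coeff (2 * i) V) z

lemma hasDerivAt_prodMk_middle (ε s y : ℝ) :
    HasDerivAt (fun y : ℝ => (ε, y, s)) ((0 : ℝ), (1 : ℝ), (0 : ℝ)) y :=
  (hasDerivAt_const y ε).prodMk ((hasDerivAt_id y).prodMk (hasDerivAt_const y s))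

lemma hasDerivAt_prodMk_right (ε x σ : ℝ) :
    HasDerivAt (fun σ : ℝ => (ε, x, σ)) ((0 : ℝ), (0 : ℝ), (1 : ℝ)) σ :=
  (hasDerivAt_const σ ε).prodMk ((hasDerivAt_const σ x).prodMk (hasDerivAt_id σ))

section Family

variable {I : Set ℝ} {w : ℝ → ℝ → ℝ → ℝ} {U : Set (ℝ × ℝ × ℝ)} {r : ℝ × ℝ × ℝ}

lemma jetAt_apply (hU : IsOpen U) (hw : ContDiffOn ℝ ∞ (fun r => w r.1 r.2.1 r.2.2) U) (k : ℕ) :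
    EqOn (fun r => jetAt w r k) ((dirDeriv (0, 1, 0))^[k] fun r => w r.1 r.2.1 r.2.2) U :=
  fun r hr => iteratedDeriv_comp_eq_dirDeriv hU hw (hasDerivAt_prodMk_middle r.1 r.2.2) k hr

lemma contDiffOn_jetAt (hU : IsOpen U) (hw : ContDiffOn ℝ ∞ (fun r => w r.1 r.2.1 r.2.2) U)
    (k : ℕ) : ContDiffOn ℝ ∞ (fun r => jetAt w r k) U :=
  (contDiffOn_iterate_dirDeriv hU hw _ k).congr (jetAt_apply hU hw k)

theorem IsMonotoneFamily.exists_isOpen {Ω : Set (ℝ × ℝ)} (hI : IsOpen I)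
    (hw : IsMonotoneFamily I Ω w) :
    ∃ U : Set (ℝ × ℝ × ℝ), IsOpen U ∧ (∀ q ∈ Ω, ((0 : ℝ), q) ∈ U) ∧
      ContDiffOn ℝ ∞ (fun r => w r.1 r.2.1 r.2.2) U ∧ MapsTo (jetAt w) U (Dom I) := by
  obtain ⟨⟨U, hU, hΩU, hsmooth⟩, hmono⟩ := hw
  refine ⟨U ∩ jetAt w ⁻¹' Dom I,
    (continuousOn_pi.2 fun k => (contDiffOn_jetAt hU hsmooth k).continuousOn).isOpen_inter_preimage
      hU (isOpen_dom hI), fun q hq => ⟨hΩU q hq, ?_⟩, hsmooth.mono inter_subset_left,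
    fun r hr => hr.2⟩
  simpa [Dom, jetAt, jet] using hmono q.1 q.2 hq

variable (hI : IsOpen I) (hU : IsOpen U) (hw : ContDiffOn ℝ ∞ (fun r => w r.1 r.2.1 r.2.2) U)
  (hD : MapsTo (jetAt w) U (Dom I))

include hU hw hD in
lemma contDiffOn_comp_jetAt {g : JetFun} (hg : IsLocal I g) :
    ContDiffOn ℝ ∞ (fun r => g (jetAt w r)) U :=
  hg.contDiffOn_comp (contDiffOn_jetAt hU hw) hD

include hU hw hD in
lemma continuousAt_comp_jetAt {g : JetFun} (hg : IsLocal I g) {q : ℝ × ℝ}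
    (hq : ((0 : ℝ), q) ∈ U) : ContinuousAt (fun ε => g (jetAt w (ε, q))) 0 := by
  have hcont : ContinuousAt (fun r => g (jetAt w r)) (0, q) :=
    (contDiffOn_comp_jetAt hU hw hD hg).continuousOn.continuousAt (hU.mem_nhds hq)
  exact hcont.comp (f := fun ε : ℝ => (ε, q)) (hasDerivAt_prodMk_left q 0).continuousAt

include hU hw in
lemma hasDerivAt_jetAt_right (hr : r ∈ U) (k : ℕ) :
    HasDerivAt (fun σ => jetAt w (r.1, r.2.1, σ) k)
      ((dirDeriv (0, 1, 0))^[k] (dirDeriv (0, 0, 1) fun r => w r.1 r.2.1 r.2.2) r) r.2.2 := by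
  have h := hasDerivAt_comp_dirDeriv (t := r.2.2) hU (contDiffOn_jetAt hU hw k) hr
    (hasDerivAt_prodMk_right r.1 r.2.1 _)
  rwa [dirDeriv_congr hU (jetAt_apply hU hw k) _ hr, ← iterate_dirDeriv_comm hU hw _ _ k hr] at h

include hU hw hD in
lemma contDiffOn_residue {B : EpsFun} (hB : IsEvenLocal I B) :
    ContDiffOn ℝ ∞ (residue B w) U := by
  unfold residue
  simp only [hB.eval6_eq]
  exact (contDiffOn_dirDeriv hU hw _).add (ContDiffOn.sum fun i hi => (contDiffOn_fst.pow _).mul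
    (contDiffOn_comp_jetAt hU hw hD (hB.isLocal i (Finset.mem_range.1 hi))))

include hI hU hw hD in
lemma iterate_dirDeriv_residue {B : EpsFun} (hB : IsEvenLocal I B) (hr : r ∈ U) (k : ℕ) :
    (dirDeriv (0, 1, 0))^[k] (residue B w) r
      = (dirDeriv (0, 1, 0))^[k] (dirDeriv (0, 0, 1) fun r => w r.1 r.2.1 r.2.2) r
        + ∑ i ∈ Finset.range 3, r.1 ^ (2 * i) * prolong (coeff (2 * i) B) (jetAt w r) k := by
  obtain ⟨ε, x, s⟩ := r
  have hslice : ContDiff ℝ ∞ fun y : ℝ => (ε, y, s) := by fun_prop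
  have hA : IsOpen ((fun y : ℝ => (ε, y, s)) ⁻¹' U) := hU.preimage hslice.continuous
  have hsmooth {Φ : ℝ × ℝ × ℝ → ℝ} (hΦ : ContDiffOn ℝ ∞ Φ U) :
      ContDiffAt ℝ k (fun y => Φ (ε, y, s)) x :=
    contDiffAt_infty.1 ((hΦ.contDiffAt (hU.mem_nhds hr)).comp x hslice.contDiffAt) k
  have hterm (i : ℕ) (hi : i ∈ Finset.range 3) :
      ContDiffAt ℝ k (fun y => ε ^ (2 * i) * coeff (2 * i) B (jetAt w (ε, y, s))) x :=
    contDiffAt_const.mul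
      (hsmooth (contDiffOn_comp_jetAt hU hw hD (hB.isLocal i (Finset.mem_range.1 hi))))
  have hjet (i : ℕ) (hi : i ∈ Finset.range 3) :
      iteratedDeriv k (fun y => coeff (2 * i) B (jetAt w (ε, y, s))) x
        = prolong (coeff (2 * i) B) (jetAt w (ε, x, s)) k :=
    iteratedDeriv_comp_jet hI (hB.isLocal i (Finset.mem_range.1 hi)) hA
      (hw.comp hslice.contDiffOn fun y hy => hy) (fun y hy => hD hy) k hr
  rw [← iteratedDeriv_comp_eq_dirDeriv hU (contDiffOn_residue hU hw hD hB)
      (hasDerivAt_prodMk_middle ε s) k hr,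
    ← iteratedDeriv_comp_eq_dirDeriv hU (contDiffOn_dirDeriv hU hw _)
      (hasDerivAt_prodMk_middle ε s) k hr]
  simp only [residue, hB.eval6_eq]
  rw [iteratedDeriv_fun_add (hsmooth (contDiffOn_dirDeriv hU hw _)) (ContDiffAt.sum hterm),
    iteratedDeriv_fun_sum hterm]
  congr 1
  exact Finset.sum_congr rfl fun i hi => by rw [iteratedDeriv_const_mul_field, hjet i hi]

include hI hU hw hD in
/-- Differentiating in `x` the equation `w_s = -B + O(ε⁶)` preserves the order of the error, so
`∂_s` acts on functions of the jet like the derivative along `-B`. -/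
theorem isBigO_deriv_comp_jetAt_add {B : EpsFun} (hB : IsEvenLocal I B) {Ω : Set (ℝ × ℝ)}
    (hΩ : IsOpen Ω) (hΩU : ∀ q ∈ Ω, ((0 : ℝ), q) ∈ U) (hsol : SolvesEvolution B Ω w) {g : JetFun}
    (hg : IsLocal I g) {q : ℝ × ℝ} (hq : q ∈ Ω) :
    (fun ε => deriv (fun σ => g (jetAt w (ε, q.1, σ))) q.2
      + ∑ i ∈ Finset.range 3, ε ^ (2 * i) * evol (coeff (2 * i) B) g (jetAt w (ε, q)))
      =O[𝓝 0] fun ε => ε ^ 6 := by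
  obtain ⟨N, hN⟩ := hg.exists_variation_eq_sum hI
  have hmem {q : ℝ × ℝ} (hq : q ∈ Ω) : ∀ᶠ ε : ℝ in 𝓝 0, (ε, q) ∈ U :=
    (hasDerivAt_prodMk_left q 0).continuousAt.preimage_mem_nhds (hU.mem_nhds (hΩU q hq))
  have hderiv {r : ℝ × ℝ × ℝ} (hr : r ∈ U) :=
    hg.hasDerivAt_comp hI (fun k => hasDerivAt_jetAt_right hU hw hr k) (hD hr)
  have hresidue : ∀ q ∈ Ω, (fun ε => residue B w (ε, q)) =O[𝓝 0] fun ε => ε ^ 6 := fun q hq => by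
    refine (hsol q.1 q.2 hq).congr' ?_ EventuallyEq.rfl
    filter_upwards [hmem hq] with ε hε
    rw [(hasDerivAt_comp_dirDeriv hU hw hε (hasDerivAt_prodMk_right ε q.1 q.2)).deriv]
    rfl
  have hterm (k : ℕ) : (fun ε => (dirDeriv (0, 1, 0))^[k] (residue B w) (ε, q)
      * pderiv k g (jetAt w (ε, q))) =O[𝓝 0] fun ε => ε ^ 6 := by
    simpa using (isBigO_iterate_dirDeriv hU (contDiffOn_residue hU hw hD hB) hΩ hΩU hresidue
      (1, 0) k q hq).mul
        ((continuousAt_comp_jetAt hU hw hD (hg.pderiv hI k) (hΩU q hq)).isBigO_one ℝ)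
  refine (IsBigO.fun_sum fun k (_ : k ∈ Finset.range N) => hterm k).congr' ?_ EventuallyEq.rfl
  filter_upwards [hmem hq] with ε hε
  rw [(hderiv hε).deriv]
  simp only [evol_eq_variation, hN _ (hD hε), iterate_dirDeriv_residue hI hU hw hD hB hε, add_mul,
    Finset.sum_add_distrib, Finset.mul_sum, Finset.sum_mul, mul_assoc]
  rw [Finset.sum_comm]

include hU hw hD in
lemma deriv_substitute {V : EpsFun} (hV : IsEvenLocal I V) (hr : r ∈ U) :
    deriv (fun σ => substitute V w r.1 r.2.1 σ) r.2.2 = ∑ j ∈ Finset.range 3,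
      r.1 ^ (2 * j) * deriv (fun σ => coeff (2 * j) V (jetAt w (r.1, r.2.1, σ))) r.2.2 := by
  have hdiff (j : ℕ) (hj : j ∈ Finset.range 3) :
      DifferentiableAt ℝ (fun σ => coeff (2 * j) V (jetAt w (r.1, r.2.1, σ))) r.2.2 :=
    (hasDerivAt_comp_dirDeriv (t := r.2.2) hU (contDiffOn_comp_jetAt hU hw hD
      (hV.isLocal j (Finset.mem_range.1 hj))) hr (hasDerivAt_prodMk_right _ _ _)).differentiableAt
  change deriv (fun σ => eval6 V r.1 (jetAt w (r.1, r.2.1, σ))) r.2.2 = _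
  simp only [hV.eval6_eq]
  rw [deriv_fun_sum fun j hj => (hdiff j hj).const_mul _]
  exact Finset.sum_congr rfl fun j hj => deriv_const_mul _ (hdiff j hj)

include hI hU hw hD in
lemma isBigO_deriv_substitute_add {B V : EpsFun} (hB : IsEvenLocal I B) (hV : IsEvenLocal I V)
    {Ω : Set (ℝ × ℝ)} (hΩ : IsOpen Ω) (hΩU : ∀ q ∈ Ω, ((0 : ℝ), q) ∈ U)
    (hsol : SolvesEvolution B Ω w) {q : ℝ × ℝ} (hq : q ∈ Ω) :
    (fun ε => deriv (fun σ => substitute V w ε q.1 σ) q.2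
      + ∑ k ∈ Finset.range 3, ε ^ (2 * k) * flowCoeff B V k (jetAt w (ε, q)))
      =O[𝓝 0] fun ε => ε ^ 6 := by
  have hterm (j : ℕ) (hj : j ∈ Finset.range 3) :
      (fun ε => ε ^ (2 * j) * (deriv (fun σ => coeff (2 * j) V (jetAt w (ε, q.1, σ))) q.2
        + ∑ i ∈ Finset.range 3, ε ^ (2 * i)
          * evol (coeff (2 * i) B) (coeff (2 * j) V) (jetAt w (ε, q)))) =O[𝓝 0] fun ε => ε ^ 6 := by
    simpa using ((continuous_pow (M := ℝ) (2 * j)).continuousAt.isBigO_one ℝ).mul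
      (isBigO_deriv_comp_jetAt_add hI hU hw hD hB hΩ hΩU hsol
        (hV.isLocal j (Finset.mem_range.1 hj)) hq)
  have hcont {i j : ℕ} (hi : i < 3) (hj : j < 3) := continuousAt_comp_jetAt hU hw hD
    ((hB.isLocal i hi).evol hI (hV.isLocal j hj)) (hΩU q hq)
  have hexcess : (fun ε : ℝ => ε ^ 6 * (evol (coeff 2 B) (coeff 4 V) (jetAt w (ε, q))
      + evol (coeff 4 B) (coeff 2 V) (jetAt w (ε, q))
      + ε ^ 2 * evol (coeff 4 B) (coeff 4 V) (jetAt w (ε, q)))) =O[𝓝 0] fun ε => ε ^ 6 := by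
    have h24 := hcont (i := 1) (j := 2) (by norm_num) (by norm_num)
    have h42 := hcont (i := 2) (j := 1) (by norm_num) (by norm_num)
    have h44 := hcont (i := 2) (j := 2) (by norm_num) (by norm_num)
    simpa using (isBigO_refl (fun ε : ℝ => ε ^ 6) (𝓝 0)).mul
      (((h24.add h42).add ((continuousAt_id.pow 2).mul h44)).isBigO_one ℝ)
  refine ((IsBigO.fun_sum hterm).sub hexcess).congr' ?_ EventuallyEq.rfl
  filter_upwards [(hasDerivAt_prodMk_left q 0).continuousAt.preimage_mem_nhds
    (hU.mem_nhds (hΩU q hq))] with ε hε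
  rw [deriv_substitute hU hw hD hV (r := (ε, q)) hε]
  simp only [flowCoeff, Finset.sum_range_succ, Finset.sum_range_zero]
  norm_num
  ring

include hI hU hw hD in
/-- The transformed family solves the transformed equation: `∂_s V(w) = -(flow of V along B)`, which
by assumption is `-A` composed with `V`. -/
lemma SolvesEvolution.substitute_of_mapsTo {A B V : EpsFun} (hA : IsEvenLocal I A)
    (hB : IsEvenLocal I B) (hV : IsSubstitution I V)
    (hcomm : ∀ k < 3, EqOn (flowCoeff B V k) (compCoeff V A k) (Dom I)) {Ω : Set (ℝ × ℝ)}
    (hΩ : IsOpen Ω) (hΩU : ∀ q ∈ Ω, ((0 : ℝ), q) ∈ U) (hsol : SolvesEvolution B Ω w) :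
    SolvesEvolution A Ω (substitute V w) := by
  intro x s hxs
  have hslice : ContDiff ℝ ∞ fun ε : ℝ => (ε, x, s) := by fun_prop
  have hflow := isBigO_deriv_substitute_add hI hU hw hD hB hV.toIsEvenLocal hΩ hΩU hsol hxs
  have hcomp := isBigO_eval6_shift_sub hI hA hV (hU.preimage hslice.continuous) (hΩU _ hxs)
    (fun k => (contDiffOn_jetAt hU hw k).comp hslice.contDiffOn fun ε hε => hε)
    fun ε hε => hD hε
  refine (hflow.add hcomp).congr' ?_ EventuallyEq.rfl
  filter_upwards [hslice.continuous.continuousAt.preimage_mem_nhds (hU.mem_nhds (hΩU _ hxs))]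
    with ε hε
  have hline : ContDiff ℝ ∞ fun y : ℝ => (ε, y, s) := by fun_prop
  have hjet : jet (fun y => substitute V w ε y s) x
      = shift (coeff 2 V) (coeff 4 V) (ε ^ 2) (jetAt w (ε, x, s)) :=
    hV.jet_eval6 hI (hU.preimage hline.continuous) (hw.comp hline.contDiffOn fun y hy => hy)
      (fun y hy => hD hy) ε hε
  have hsum : ∑ k ∈ Finset.range 3, ε ^ (2 * k) * flowCoeff B V k (jetAt w (ε, x, s))
      = ∑ k ∈ Finset.range 3, ε ^ (2 * k) * compCoeff V A k (jetAt w (ε, x, s)) :=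
    Finset.sum_congr rfl fun k hk => by rw [hcomm k (Finset.mem_range.1 hk) (hD hε)]
  rw [hjet]
  simp only [hsum, Function.comp_apply]
  ring

end Family

theorem SolvesEvolution.substitute {I : Set ℝ} (hI : IsOpen I) {A B V : EpsFun}
    (hA : IsEvenLocal I A) (hB : IsEvenLocal I B) (hV : IsSubstitution I V)
    (hcomm : ∀ k < 3, EqOn (flowCoeff B V k) (compCoeff V A k) (Dom I)) {Ω : Set (ℝ × ℝ)}
    (hΩ : IsOpen Ω) {w : ℝ → ℝ → ℝ → ℝ} (hw : IsMonotoneFamily I Ω w)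
    (hsol : SolvesEvolution B Ω w) : SolvesEvolution A Ω (substitute V w) := by
  obtain ⟨U, hU, hΩU, hsmooth, hD⟩ := hw.exists_isOpen hI
  exact hsol.substitute_of_mapsTo hI hU hsmooth hD hA hB hV hcomm hΩ hΩU

/-! ### Canonical transformations -/

section Canonical

open PowerSeries (coeff)
open Finset.HasAntidiagonal (antidiagonal)

lemma euler_zero : euler 0 = 0 := by
  funext z
  simp [euler, pderiv_zero, iterate_totalD_zero]

lemma evol_zero_left (g : JetFun) : evol 0 g = 0 := by
  funext z
  simp [evol, iterate_totalD_zero]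

lemma evol_zero_right (w : JetFun) : evol w 0 = 0 := by
  funext z
  simp [evol, pderiv_zero]

lemma pderiv_neg (k : ℕ) (g : JetFun) : pderiv k (-g) = -pderiv k g := by
  funext z
  simp [pderiv, deriv.fun_neg]

lemma totalD_neg (g : JetFun) : totalD (-g) = -totalD g := by
  funext z
  simp [totalD, pderiv_neg, finsum_neg_distrib]

lemma iterate_totalD_neg (k : ℕ) (g : JetFun) : totalD^[k] (-g) = -totalD^[k] g :=
  (Function.Semiconj.iterate_right (f := Neg.neg) (fun g => (totalD_neg g).symm) k g).symm

lemma euler_neg (g : JetFun) : euler (-g) = -euler g := by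
  funext z
  simp [euler, pderiv_neg, iterate_totalD_neg, finsum_neg_distrib]

lemma evol_neg_left (w g : JetFun) : evol (-w) g = -evol w g := by
  funext z
  simp [evol, iterate_totalD_neg, finsum_neg_distrib]

lemma evol_neg_right (w g : JetFun) : evol w (-g) = -evol w g := by
  funext z
  simp [evol, pderiv_neg, finsum_neg_distrib]

lemma coeff_hamField (h : EpsFun) (n : ℕ) : coeff n (hamField h) = totalD (euler (coeff n h)) :=
  PowerSeries.coeff_mk _ _

lemma hamField_neg (h : EpsFun) : hamField (-h) = -hamField h := by
  ext1 n
  simp only [coeff_hamField, map_neg, euler_neg, totalD_neg]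

variable {I : Set ℝ} {F V W κ : EpsFun}

lemma IsEvenLocal.hamField (hI : IsOpen I) (hF : IsEvenLocal I F) :
    IsEvenLocal I (hamField F) where
  coeff_odd i hi := by rw [coeff_hamField, hF.coeff_odd i hi, euler_zero, totalD_zero]
  isLocal i hi := by
    rw [coeff_hamField]
    exact ((hF.isLocal i hi).euler hI).totalD hI

lemma coeff_bracket_iterate_succ (κ F : EpsFun) (m n : ℕ) :
    coeff n ((fun F => bracket F κ)^[m + 1] F) = ∑ q ∈ antidiagonal n,
      evol (coeff q.1 (hamField κ)) (coeff q.2 ((fun F => bracket F κ)^[m] F)) := by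
  rw [Function.iterate_succ_apply']
  exact PowerSeries.coeff_mk _ _

lemma coeff_canonical (κ : EpsFun) (n : ℕ) : coeff n (canonical κ) =
    ∑ m ∈ Finset.range (n + 1), ((m ! : ℝ)⁻¹) •
      coeff (n - m) ((fun F => bracket F κ)^[m] (PowerSeries.C (coord 0))) := by
  rw [canonical, PowerSeries.coeff_mk]
  refine Finset.sum_congr rfl fun m hm => ?_
  rw [PowerSeries.coeff_X_pow_mul', if_pos (Nat.lt_succ_iff.1 (Finset.mem_range.1 hm))]

lemma coeff_canonical_zero (κ : EpsFun) : coeff 0 (canonical κ) = coord 0 := by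
  simp [coeff_canonical]

lemma coeff_bracket_coord_zero (κ : EpsFun) (n : ℕ) :
    coeff n (bracket (PowerSeries.C (coord 0)) κ) = coeff n (hamField κ) := by
  rw [bracket, PowerSeries.coeff_mk, Finset.sum_eq_single (n, 0)]
  · simp [evol_coord_zero]
  · intro q hq hne
    have hsum := Finset.HasAntidiagonal.mem_antidiagonal.1 hq
    have hq2 : q.2 ≠ 0 := fun h => hne (Prod.ext (by simpa [h] using hsum) h)
    rw [PowerSeries.coeff_C, if_neg hq2, evol_zero_right]
  · simp

section Odd

variable (hκ : ∀ n, Even n → coeff n κ = 0)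
include hκ

lemma coeff_hamField_of_even {n : ℕ} (hn : Even n) : coeff n (hamField κ) = 0 := by
  rw [coeff_hamField, hκ n hn, euler_zero, totalD_zero]

lemma coeff_bracket_iterate_eq_zero (m : ℕ) : ∀ n, n < m ∨ Odd (n + m) →
    coeff n ((fun F => bracket F κ)^[m] (PowerSeries.C (coord 0))) = 0 := by
  induction m with
  | zero =>
    intro n hn
    have hn0 : n ≠ 0 := by
      rintro rfl
      simp at hn
    simp [PowerSeries.coeff_C, hn0]
  | succ m ih =>
    intro n hn
    rw [coeff_bracket_iterate_succ]
    refine Finset.sum_eq_zero fun q hq => ?_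
    rw [Finset.HasAntidiagonal.mem_antidiagonal] at hq
    rcases Nat.even_or_odd q.1 with hq1 | hq1
    · rw [coeff_hamField_of_even hκ hq1, evol_zero_left]
    · rw [ih q.2, evol_zero_right]
      grind

lemma coeff_canonical_odd {n : ℕ} (hn : Odd n) : coeff n (canonical κ) = 0 := by
  rw [coeff_canonical]
  refine Finset.sum_eq_zero fun m hm => ?_
  rw [Finset.mem_range] at hm
  rw [coeff_bracket_iterate_eq_zero hκ m _ (by grind), smul_zero]

lemma coeff_canonical_two : coeff 2 (canonical κ) = coeff 1 (hamField κ) := by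
  simp [coeff_canonical, Finset.sum_range_succ, coeff_bracket_coord_zero,
    coeff_bracket_iterate_eq_zero hκ 2 0, -Function.iterate_succ,
    -PowerSeries.coeff_zero_eq_constantCoeff]

lemma coeff_canonical_four : coeff 4 (canonical κ) =
    coeff 3 (hamField κ) + (1 / 2 : ℝ) • evol (coeff 1 (hamField κ)) (coeff 1 (hamField κ)) := by
  have h2 : coeff 2 ((fun F => bracket F κ)^[2] (PowerSeries.C (coord 0)))
      = evol (coeff 1 (hamField κ)) (coeff 1 (hamField κ)) := by
    have h0 : coeff 0 (hamField κ) = 0 := coeff_hamField_of_even hκ (by decide)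
    have h2 : coeff 2 (hamField κ) = 0 := coeff_hamField_of_even hκ (by decide)
    rw [coeff_bracket_iterate_succ]
    simp [Finset.Nat.antidiagonal_succ, coeff_bracket_coord_zero, h0, h2, evol_zero_left,
      -PowerSeries.coeff_zero_eq_constantCoeff]
  simp [coeff_canonical, Finset.sum_range_succ, coeff_bracket_coord_zero, h2,
    coeff_bracket_iterate_eq_zero hκ 3 1, coeff_bracket_iterate_eq_zero hκ 4 0,
    -Function.iterate_succ, -PowerSeries.coeff_zero_eq_constantCoeff]

lemma coeff_canonical_neg_two : coeff 2 (canonical (-κ)) = -coeff 2 (canonical κ) := by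
  rw [coeff_canonical_two fun n hn => by rw [map_neg, hκ n hn, neg_zero], coeff_canonical_two hκ,
    hamField_neg, map_neg]

lemma coeff_canonical_neg_four : coeff 4 (canonical (-κ)) =
    evol (coeff 2 (canonical κ)) (coeff 2 (canonical κ)) - coeff 4 (canonical κ) := by
  rw [coeff_canonical_four fun n hn => by rw [map_neg, hκ n hn, neg_zero], coeff_canonical_four hκ,
    coeff_canonical_two hκ, hamField_neg, map_neg, map_neg, evol_neg_left, evol_neg_right, neg_neg]
  module

lemma isSubstitution_canonical (hI : IsOpen I) (h1 : IsLocal I (coeff 1 κ))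
    (h3 : IsLocal I (coeff 3 κ)) : IsSubstitution I (canonical κ) where
  coeff_zero := coeff_canonical_zero κ
  coeff_odd i _ := coeff_canonical_odd hκ (odd_two_mul_add_one i)
  isLocal i hi := by
    have hlocal {n : ℕ} (hn : IsLocal I (coeff n κ)) : IsLocal I (coeff n (hamField κ)) := by
      rw [coeff_hamField]
      exact (hn.euler hI).totalD hI
    interval_cases i
    · rw [coeff_canonical_zero]
      exact IsLocal.coord I 0
    · rw [coeff_canonical_two hκ]
      exact hlocal h1
    · rw [coeff_canonical_four hκ]
      exact (hlocal h3).add (((hlocal h1).evol hI (hlocal h1)).smul _)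

end Odd

/-! ### Inverse substitutions and functions of substitutions -/

lemma secondVariation_coord (h : Jet) (k : ℕ) (z : Jet) : secondVariation h (coord k) z = 0 := by
  have hpderiv (j : ℕ) : pderiv j (coord k) = fun _ => if j = k then 1 else 0 := by
    funext z
    by_cases hjk : j = k <;> simp [pderiv, coord, hjk, Ne.symm]
  simp [secondVariation, hpderiv, variation_const]

lemma compCoeff_eq_zero (hI : IsOpen I) (hW : IsSubstitution I W)
    (h2 : EqOn (coeff 2 W) (-coeff 2 V) (Dom I))
    (h4 : EqOn (coeff 4 W) (evol (coeff 2 V) (coeff 2 V) - coeff 4 V) (Dom I)) :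
    ∀ k < 2, EqOn (compCoeff V W (k + 1)) 0 (Dom I) := by
  intro k hk z hz
  have hevol : evol (coeff 2 V) (coeff 2 W) z = -evol (coeff 2 V) (coeff 2 V) z := by
    rw [evol_congr hI (fun _ _ => rfl) h2 hz, evol_neg_right, Pi.neg_apply]
  interval_cases k
  · simp [compCoeff, shiftCoeff, Finset.sum_range_succ, hW.coeff_zero, evol_coord_zero, h2 hz,
      -PowerSeries.coeff_zero_eq_constantCoeff]
  · simp [compCoeff, shiftCoeff, Finset.sum_range_succ, hW.coeff_zero, evol_coord_zero, hevol,
      h4 hz, secondVariation_coord, -PowerSeries.coeff_zero_eq_constantCoeff]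
    ring

lemma compCoeff_eq_zero_of_canonical (hκ : ∀ n, Even n → coeff n κ = 0) (hI : IsOpen I)
    (hW : IsSubstitution I W) (hcanV : ∀ k < 6, EqOn (coeff k V) (coeff k (canonical κ)) (Dom I))
    (hcanW : ∀ k < 6, EqOn (coeff k W) (coeff k (canonical (-κ))) (Dom I)) :
    ∀ k < 2, EqOn (compCoeff V W (k + 1)) 0 (Dom I) := by
  have hV2 := hcanV 2 (by norm_num)
  refine compCoeff_eq_zero hI hW (fun z hz => ?_) fun z hz => ?_
  · rw [hcanW 2 (by norm_num) hz, coeff_canonical_neg_two hκ, Pi.neg_apply, Pi.neg_apply, hV2 hz]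
  · rw [hcanW 4 (by norm_num) hz, coeff_canonical_neg_four hκ, Pi.sub_apply, Pi.sub_apply,
      hcanV 4 (by norm_num) hz, evol_congr hI hV2 hV2 hz]

lemma coeff_monomial_odd (h₀ h₂ h₄ : JetFun) (i : ℕ) : coeff (2 * i + 1)
    (PowerSeries.monomial 0 h₀ + PowerSeries.monomial 2 h₂ + PowerSeries.monomial 4 h₄) = 0 := by
  simp [PowerSeries.coeff_monomial, show 2 * i + 1 ≠ 2 by lia, show 2 * i + 1 ≠ 4 by lia]

lemma coeff_applyFun_zero (f : ℝ → ℝ) (V : EpsFun) :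
    coeff 0 (applyFun f V) = fun z => f (z 0) := by
  funext z
  simp [applyFun, -PowerSeries.coeff_zero_eq_constantCoeff]

section ApplyFun

variable (hV : IsSubstitution I V) (f : ℝ → ℝ)
include hV

lemma IsSubstitution.coeff_sub_pow (j n : ℕ) :
    coeff n ((V - PowerSeries.C (coord 0)) ^ j) = if 2 * j ≤ n then
      coeff (n - 2 * j) ((PowerSeries.mk fun n => coeff (n + 2) V) ^ j) else 0 := by
  have hfactor : V - PowerSeries.C (coord 0)
      = PowerSeries.X ^ 2 * PowerSeries.mk fun n => coeff (n + 2) V := by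
    ext1 n
    rw [PowerSeries.coeff_X_pow_mul', map_sub, PowerSeries.coeff_C]
    rcases n with _ | _ | n
    · simp [hV.coeff_zero, -PowerSeries.coeff_zero_eq_constantCoeff]
    · simpa using hV.coeff_odd 0 (by norm_num)
    · simp
  rw [hfactor, mul_pow, ← pow_mul, PowerSeries.coeff_X_pow_mul']

lemma IsSubstitution.coeff_applyFun_two :
    coeff 2 (applyFun f V) = fun z => iteratedDeriv 1 f (z 0) * coeff 2 V z := by
  funext z
  simp [applyFun, Finset.sum_range_succ, hV.coeff_sub_pow, PowerSeries.coeff_one,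
    -PowerSeries.coeff_zero_eq_constantCoeff]

lemma IsSubstitution.coeff_applyFun_four : coeff 4 (applyFun f V) = fun z =>
    iteratedDeriv 1 f (z 0) * coeff 4 V z
      + 1 / 2 * (iteratedDeriv 2 f (z 0) * coeff 2 V z ^ 2) := by
  funext z
  simp [applyFun, Finset.sum_range_succ, hV.coeff_sub_pow, PowerSeries.coeff_one]
  ring

lemma IsSubstitution.coeff_applyFun_odd (i : ℕ) (hi : i < 3) :
    coeff (2 * i + 1) (applyFun f V) = 0 := by
  have h3 : coeff 3 V = 0 := hV.coeff_odd 1 (by norm_num)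
  have h5 : coeff 5 V = 0 := hV.coeff_odd 2 (by norm_num)
  funext z
  interval_cases i <;>
    simp [applyFun, Finset.sum_range_succ, hV.coeff_sub_pow, PowerSeries.coeff_one, sq, h3, h5,
      PowerSeries.coeff_mul, Finset.Nat.antidiagonal_succ]

end ApplyFun

end Canonical

/-! ### Differential polynomials -/

/-- The names of the functions of `u` from which differential polynomials are built. -/
inductive Param
  | c
  | p
  | f

/-- The generators of the algebra of differential polynomials over the Laurent polynomials in
`u_x`: the jet variables `u^{(k)}`, the logarithm `log |u_x|` and the derivatives `F_i^{(j)}(u)`. -/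
inductive Gen
  | jet (k : ℕ)
  | log
  | fn (i : Param) (j : ℕ)

/-- The monomial `u_x ^ exp ∏_{a ∈ gens} a`. In a normal form the list is decreasing with respect to
`Gen.code`; correctness does not depend on this. -/
structure Monomial where
  exp : ℤ
  gens : List Gen

/-- Linear combinations of monomials, as lists of pairs of a coefficient and a monomial. In a normal
form the coefficients are nonzero and the monomials increase with respect to `Monomial.cmp`. This
is a model of a class of local functions in which the kernel can compute. -/
abbrev DiffPoly : Type := List (ℚ × Monomial)

/-- A numbering of the generators, by which they are ordered. -/
def Gen.code : Gen → ℕ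
  | jet k => 5 * k
  | fn .c j => 5 * j + 1
  | fn .p j => 5 * j + 2
  | fn .f j => 5 * j + 3
  | log => 4

/-- An upper bound for the orders `k < ord` of the jet variables in a generator. -/
def Gen.ord : Gen → ℕ
  | jet k => k + 1
  | log => 2
  | fn _ _ => 1

namespace Monomial

/-- Multiplication of monomials. -/
def mul (m n : Monomial) : Monomial :=
  ⟨m.exp + n.exp, m.gens.foldr (List.orderedInsert fun a b => b.code ≤ a.code) n.gens⟩

/-- The comparison of monomials which orders the terms of differential polynomials. -/
def cmp (m n : Monomial) : Ordering :=
  (compare (m.gens.map Gen.code) (n.gens.map Gen.code)).then (compare m.exp n.exp)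

end Monomial

namespace DiffPoly

/-- Adds `t + P` to a polynomial, given the function `addP` which adds `P`: the step of the
recursion for `DiffPoly.add`. -/
def addCons (t : ℚ × Monomial) (P : DiffPoly) (addP : DiffPoly → DiffPoly) : DiffPoly → DiffPoly
  | [] => t :: P
  | s :: Q =>
    match t.2.cmp s.2 with
    | .lt => t :: addP (s :: Q)
    | .eq => if t.1 + s.1 = 0 then addP Q else (t.1 + s.1, t.2) :: addP Q
    | .gt => s :: addCons t P addP Q

/-- Addition, by merging the lists of terms. -/
protected def add : DiffPoly → DiffPoly → DiffPoly
  | [], Q => Q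
  | t :: P, Q => addCons t P (DiffPoly.add P) Q

/-- Multiplication by a term. -/
def mulTerm (q : ℚ) (m : Monomial) (P : DiffPoly) : DiffPoly :=
  if q = 0 then [] else List.map (fun t => (q * t.1, m.mul t.2)) P

instance : Zero DiffPoly := ⟨[]⟩
instance : One DiffPoly := ⟨[(1, ⟨0, []⟩)]⟩
instance : Add DiffPoly := ⟨DiffPoly.add⟩
instance : SMul ℚ DiffPoly := ⟨fun q P => mulTerm q ⟨0, []⟩ P⟩
instance : Neg DiffPoly := ⟨fun P => (-1 : ℚ) • P⟩
instance : Sub DiffPoly := ⟨fun P Q => P + -Q⟩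
instance : Mul DiffPoly := ⟨fun P Q => (List.map (fun t => mulTerm t.1 t.2 Q) P).sum⟩
instance : Pow DiffPoly ℕ := ⟨fun P n => npowRec n P⟩

/-- The power `u_x ^ e`. -/
def ux (e : ℤ) : DiffPoly := [(1, ⟨e, []⟩)]

/-- A generator as a differential polynomial. -/
def gen (a : Gen) : DiffPoly := [(1, ⟨0, [a]⟩)]

/-- The jet variable `u^{(k)}`. -/
def jet : ℕ → DiffPoly
  | 1 => ux 1
  | k => gen (.jet k)

/-- The function `F_i^{(j)}(u)`. -/
def fn (i : Param) (j : ℕ) : DiffPoly := gen (.fn i j)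

/-- The derivative of a generator along a field with the components `w k` in the directions of
`u^{(k)}`. -/
def alongGen (w : ℕ → DiffPoly) : Gen → DiffPoly
  | .jet k => w k
  | .log => mulTerm 1 ⟨-1, []⟩ (w 1)
  | .fn i j => mulTerm 1 ⟨0, [.fn i (j + 1)]⟩ (w 0)

/-- The derivative of a product of generators along a field. -/
def alongGens (w : ℕ → DiffPoly) : List Gen → DiffPoly
  | [] => 0
  | a :: l => mulTerm 1 ⟨0, l⟩ (alongGen w a) + mulTerm 1 ⟨0, [a]⟩ (alongGens w l)

/-- The derivative of a differential polynomial along the field `∑ₖ w k ∂/∂u^{(k)}`. -/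
def along (w : ℕ → DiffPoly) (P : DiffPoly) : DiffPoly :=
  (List.map (fun t => mulTerm (t.1 * t.2.exp) ⟨t.2.exp - 1, t.2.gens⟩ (w 1)
    + mulTerm t.1 ⟨t.2.exp, []⟩ (alongGens w t.2.gens)) P).sum

/-- The operator `pderiv k` on differential polynomials. -/
def pd (k : ℕ) : DiffPoly → DiffPoly :=
  along fun j => if j = k then 1 else 0

/-- The operator `totalD` on differential polynomials. -/
def total : DiffPoly → DiffPoly :=
  along fun k => jet (k + 1)

/-- The operator `evol` on differential polynomials. -/
def ev (w : DiffPoly) : DiffPoly → DiffPoly :=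
  along fun k => total^[k] w

/-- An upper bound for the orders `k < ord` of the jet variables in a differential polynomial. -/
def ord (P : DiffPoly) : ℕ :=
  (2 :: P.flatMap fun t => t.2.gens.map Gen.ord).foldr max ⊥

/-- The operator `euler` on differential polynomials. -/
def eulerLagrange (P : DiffPoly) : DiffPoly :=
  ((List.range P.ord).map fun k => ((-1 : ℚ) ^ k) • total^[k] (pd k P)).sum

/-- The operator `∂_x δ/δu` on differential polynomials. -/
def ham (P : DiffPoly) : DiffPoly :=
  total (eulerLagrange P)

/-- The operator `secondVariation` on differential polynomials. -/
def second (w : ℕ → DiffPoly) (P : DiffPoly) : DiffPoly :=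
  ((List.range P.ord).map fun k => w k * along w (pd k P)).sum

/-- The coefficients `shiftCoeff` for differential polynomials. -/
def shiftCoeff (T₁ T₂ P : DiffPoly) : ℕ → DiffPoly
  | 0 => P
  | 1 => T₁.ev P
  | 2 => T₂.ev P + (1 / 2 : ℚ) • P.second fun k => total^[k] T₁
  | _ => 0

/-- The coefficients `compCoeff` for differential polynomials; here, as everywhere for sequences of
differential polynomials, the `k`-th one is the coefficient of `ε^{2k}`. -/
def compCoeff (V F : ℕ → DiffPoly) (k : ℕ) : DiffPoly :=
  ((List.range (k + 1)).map fun i => shiftCoeff (V 1) (V 2) (F i) (k - i)).sum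

/-- The coefficients `flowCoeff` for differential polynomials. -/
def flowCoeff (B V : ℕ → DiffPoly) (k : ℕ) : DiffPoly :=
  ((List.range (k + 1)).map fun i => (B (k - i)).ev (V i)).sum

/-- The equality of differential polynomials, up to normalization. -/
def same (P Q : DiffPoly) : Bool :=
  List.isEmpty (P - Q)

end DiffPoly

/-! ### Values of differential polynomials -/

variable {I : Set ℝ} {F : Param → ℝ → ℝ} {z : Jet}

/-- The function of the jet denoted by a generator, for given functions `F i` of `u`. -/
def Gen.eval (F : Param → ℝ → ℝ) : Gen → JetFun
  | jet k => coord k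
  | log => fun z => Real.log (z 1)
  | fn i j => fun z => iteratedDeriv j (F i) (z 0)

/-- The function of the jet denoted by a monomial. -/
def Monomial.eval (F : Param → ℝ → ℝ) (m : Monomial) : JetFun :=
  (fun z => z 1 ^ m.exp) * (m.gens.map (Gen.eval F)).prod

/-- The function of the jet denoted by a differential polynomial. -/
def DiffPoly.eval (F : Param → ℝ → ℝ) (P : DiffPoly) : JetFun :=
  (List.map (fun t : ℚ × Monomial => (t.1 : ℝ) • t.2.eval F) P).sum

lemma Gen.code_injective : Function.Injective Gen.code := by
  intro a b h
  rcases a with k | _ | ⟨_ | _ | _, j⟩ <;> rcases b with l | _ | ⟨_ | _ | _, i⟩ <;>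
    simp only [Gen.code] at h <;> first | rfl | (exfalso; omega) | (congr 1; omega)

lemma Monomial.eq_of_cmp_eq {m n : Monomial} (h : m.cmp n = .eq) : m = n := by
  obtain ⟨hgens, hexp⟩ := Ordering.then_eq_eq.1 h
  have hgens := Gen.code_injective.list_map (Std.LawfulEqOrd.eq_of_compare hgens)
  have hexp := Std.LawfulEqOrd.eq_of_compare hexp
  cases m
  cases n
  simp_all

lemma prod_map_foldr_orderedInsert {α M : Type*} [CommMonoid M] (r : α → α → Prop)
    [DecidableRel r] (v : α → M) (l m : List α) :
    ((l.foldr (List.orderedInsert r) m).map v).prod = (l.map v).prod * (m.map v).prod := by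
  induction l with
  | nil => simp
  | cons a l ih =>
    simp [((List.perm_orderedInsert r a _).map v).prod_eq, ih, mul_assoc]

lemma Monomial.eval_mul (hz : z 1 ≠ 0) (m n : Monomial) :
    (m.mul n).eval F z = m.eval F z * n.eval F z := by
  simp only [eval, mul, Pi.mul_apply, prod_map_foldr_orderedInsert, zpow_add₀ hz]
  ring

namespace DiffPoly

@[simp] lemma eval_zero : eval F 0 = 0 := rfl

@[simp] lemma eval_one : eval F 1 = 1 := by
  change eval F [(1, ⟨0, []⟩)] = 1
  funext z
  simp [eval, Monomial.eval]

lemma eval_cons (t : ℚ × Monomial) (P : DiffPoly) :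
    eval F (t :: P) = (t.1 : ℝ) • t.2.eval F + eval F P := by
  simp [eval]

lemma eval_addCons {t : ℚ × Monomial} {P : DiffPoly} {addP : DiffPoly → DiffPoly}
    (h : ∀ Q, eval F (addP Q) = eval F P + eval F Q) (Q : DiffPoly) :
    eval F (addCons t P addP Q) = eval F (t :: P) + eval F Q := by
  induction Q with
  | nil => exact (add_zero _).symm
  | cons s Q ih =>
    rw [addCons]
    rcases hcmp : t.2.cmp s.2
    · simp only [eval_cons, h]
      abel
    · have hadd : (t.1 : ℝ) • t.2.eval F + (s.1 : ℝ) • s.2.eval F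
          = ((t.1 + s.1 : ℚ) : ℝ) • t.2.eval F := by
        rw [← Monomial.eq_of_cmp_eq hcmp]
        push_cast
        rw [add_smul]
      dsimp only
      rw [eval_cons, eval_cons, add_add_add_comm, hadd]
      split_ifs with hzero
      · simp [hzero, h]
      · rw [eval_cons, h]
    · simp only [eval_cons, ih]
      abel

@[simp] lemma eval_add (P Q : DiffPoly) : eval F (P + Q) = eval F P + eval F Q := by
  induction P generalizing Q with
  | nil => exact (zero_add _).symm
  | cons t P ih => exact eval_addCons ih Q

lemma eval_sum (L : List DiffPoly) : eval F L.sum = (L.map (eval F)).sum := by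
  induction L with
  | nil => rfl
  | cons P L ih => simp [ih]

lemma eval_sum_range (n : ℕ) (P : ℕ → DiffPoly) :
    eval F ((List.range n).map P).sum z = ∑ k ∈ Finset.range n, eval F (P k) z := by
  rw [eval_sum, List.map_map, ← Finset.sum_apply]
  rfl

lemma eval_mulTerm (hz : z 1 ≠ 0) (q : ℚ) (m : Monomial) (P : DiffPoly) :
    eval F (mulTerm q m P) z = q * m.eval F z * eval F P z := by
  unfold mulTerm
  split_ifs with hq
  · simp [hq, eval]
  · induction P with
    | nil => simp [eval]
    | cons t P ih =>
      rw [List.map_cons, eval_cons, eval_cons]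
      simp only [Pi.add_apply, Pi.smul_apply, smul_eq_mul, ih, Monomial.eval_mul hz]
      push_cast
      ring

lemma eval_smul (hz : z 1 ≠ 0) (q : ℚ) (P : DiffPoly) : eval F (q • P) z = q * eval F P z :=
  (eval_mulTerm hz q ⟨0, []⟩ P).trans <| by simp only [Monomial.eval, zpow_zero, List.map_nil,
    List.prod_nil, Pi.mul_apply, Pi.one_apply, mul_one]

lemma eval_neg (hz : z 1 ≠ 0) (P : DiffPoly) : eval F (-P) z = -eval F P z :=
  (eval_smul hz (-1) P).trans (by rw [Rat.cast_neg, Rat.cast_one, neg_one_mul])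

lemma eval_sub (hz : z 1 ≠ 0) (P Q : DiffPoly) : eval F (P - Q) z = eval F P z - eval F Q z := by
  change eval F (P + -Q) z = _
  rw [eval_add, Pi.add_apply, eval_neg hz, sub_eq_add_neg]

lemma eval_mul (hz : z 1 ≠ 0) (P Q : DiffPoly) : eval F (P * Q) z = eval F P z * eval F Q z := by
  induction P with
  | nil => exact (zero_mul _).symm
  | cons t P ih =>
    change eval F (mulTerm t.1 t.2 Q + P * Q) z = _
    simp only [eval_add, Pi.add_apply, eval_mulTerm hz, ih, eval_cons, Pi.smul_apply, smul_eq_mul]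
    ring

lemma eval_pow (hz : z 1 ≠ 0) (P : DiffPoly) (n : ℕ) : eval F (P ^ n) z = eval F P z ^ n := by
  induction n with
  | zero => exact (congr_fun eval_one z).trans (_root_.pow_zero _).symm
  | succ n ih =>
    change eval F (P ^ n * P) z = _
    rw [eval_mul hz, ih, _root_.pow_succ]

lemma eval_ux (e : ℤ) : eval F (ux e) z = z 1 ^ e := by
  simp [eval, ux, Monomial.eval]

lemma eval_gen (a : Gen) : eval F (gen a) z = a.eval F z := by
  simp [eval, gen, Monomial.eval]

lemma eval_jet (k : ℕ) : eval F (jet k) z = z k := by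
  unfold jet
  split
  · simp [eval_ux]
  · exact eval_gen _

lemma eval_fn (i : Param) (j : ℕ) : eval F (fn i j) z = iteratedDeriv j (F i) (z 0) :=
  eval_gen _

lemma eqOn_of_same {P Q : DiffPoly} (h : same P Q = true) : EqOn (eval F P) (eval F Q) (Dom I) := by
  intro z hz
  have hzero : P - Q = 0 := List.isEmpty_iff.1 h
  rw [← sub_eq_zero, ← eval_sub hz.2, hzero, eval_zero, Pi.zero_apply]

end DiffPoly

/-! ### Differential operators on differential polynomials -/

section Local

lemma isLocal_zpow (I : Set ℝ) (e : ℤ) : IsLocal I fun z => z 1 ^ e :=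
  IsLocal.comp (F := fun x : ℝ => x ^ e) (S := {0}ᶜ)
    (fun _ hx => (analyticAt_id.zpow hx).contDiffAt.contDiffWithinAt) (.coord I 1)
    fun _ hz => hz.2

variable (hI : IsOpen I) (hF : ∀ i, ContDiffOn ℝ ∞ (F i) I)

include hI hF

lemma Gen.isLocal_eval (a : Gen) : IsLocal I (a.eval F) := by
  cases a with
  | jet k => exact .coord I k
  | log => exact IsLocal.comp Real.contDiffOn_log (.coord I 1) fun _ hz => hz.2
  | fn i j =>
    exact IsLocal.comp (contDiffOn_iteratedDeriv hI (hF i) j) (.coord I 0) fun _ hz => hz.1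

lemma isLocal_prod_map_eval (l : List Gen) : IsLocal I (l.map (Gen.eval F)).prod := by
  induction l with
  | nil => exact .const I 1
  | cons a l ih =>
    rw [List.map_cons, List.prod_cons]
    exact (a.isLocal_eval hI hF).mul ih

lemma Monomial.isLocal_eval (m : Monomial) : IsLocal I (m.eval F) :=
  (isLocal_zpow I m.exp).mul (isLocal_prod_map_eval hI hF m.gens)

lemma DiffPoly.isLocal_eval (P : DiffPoly) : IsLocal I (P.eval F) := by
  induction P with
  | nil => exact .const I 0
  | cons t P ih =>
    rw [DiffPoly.eval_cons]
    exact ((t.2.isLocal_eval hI hF).smul _).add ih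

variable {h : Jet} {w : ℕ → DiffPoly} (hz : z ∈ Dom I) (hw : ∀ k, (w k).eval F z = h k)

include hz hw

omit hF in
lemma variation_zpow (e : ℤ) :
    variation h (fun z => z 1 ^ e) z = e * z 1 ^ (e - 1) * (w 1).eval F z := by
  rw [hw, ← variation_coord h 1 z]
  exact variation_comp h hI (.coord I 1) hz (isLocal_zpow I e)
    (hasDerivAt_zpow e (z 1) (Or.inl hz.2))

lemma Gen.variation_eval (a : Gen) :
    variation h (a.eval F) z = (DiffPoly.alongGen w a).eval F z := by
  have ha := a.isLocal_eval hI hF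
  cases a with
  | jet k => exact (variation_coord h k z).trans (hw k).symm
  | log =>
    rw [DiffPoly.alongGen, DiffPoly.eval_mulTerm hz.2, hw]
    refine (variation_comp h hI (.coord I 1) hz ha (Real.hasDerivAt_log hz.2)).trans ?_
    simp [variation_coord, Monomial.eval, coord]
  | fn i j =>
    rw [DiffPoly.alongGen, DiffPoly.eval_mulTerm hz.2, hw]
    refine (variation_comp h hI (.coord I 0) hz ha
      (hasDerivAt_iteratedDeriv hI (hF i) j hz.1)).trans ?_
    simp [variation_coord, Monomial.eval, Gen.eval, coord]

lemma variation_prod_map_eval (l : List Gen) :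
    variation h (l.map (Gen.eval F)).prod z = (DiffPoly.alongGens w l).eval F z := by
  induction l with
  | nil => exact variation_const h 1 z
  | cons a l ih =>
    rw [List.map_cons, List.prod_cons, variation_mul h hI (a.isLocal_eval hI hF)
      (isLocal_prod_map_eval hI hF l) hz, a.variation_eval hI hF hz hw, ih, DiffPoly.alongGens,
      DiffPoly.eval_add, Pi.add_apply, DiffPoly.eval_mulTerm hz.2, DiffPoly.eval_mulTerm hz.2]
    simp only [Monomial.eval, List.map_cons, List.map_nil, List.prod_cons, List.prod_nil,
      Pi.mul_apply, Pi.one_apply, zpow_zero, Rat.cast_one]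
    ring

theorem DiffPoly.variation_eval (P : DiffPoly) :
    variation h (P.eval F) z = (P.along w).eval F z := by
  induction P with
  | nil => exact variation_const h 0 z
  | cons t P ih =>
    have hterm := variation_mul h hI (isLocal_zpow I t.2.exp)
      (isLocal_prod_map_eval hI hF t.2.gens) hz
    rw [variation_zpow hI hz hw, variation_prod_map_eval hI hF hz hw] at hterm
    rw [eval_cons, variation_add h hI ((t.2.isLocal_eval hI hF).smul _) (isLocal_eval hI hF P) hz,
      variation_smul, ih]
    change _ * variation h (_ * _) z + _ = eval F (_ + along w P) z
    rw [hterm]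
    simp only [eval_add, Pi.add_apply, eval_mulTerm hz.2, Monomial.eval, Pi.mul_apply,
      List.map_nil, List.prod_nil, Pi.one_apply]
    push_cast
    ring

end Local

lemma variation_single (k : ℕ) (g : JetFun) (z : Jet) :
    variation (Pi.single (M := fun _ => ℝ) k 1) g z = pderiv k g z := by
  rw [variation, finsum_eq_single _ k fun j hj => by simp [hj]]
  simp

lemma Gen.eval_update {a : Gen} {k : ℕ} (hk : 2 ≤ k) (ha : a.ord ≤ k) (z : Jet) (t : ℝ) :
    a.eval F (Function.update z k t) = a.eval F z := by
  cases a with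
  | jet j => exact Function.update_of_ne (Nat.ne_of_lt ha) t z
  | log => simp [Gen.eval, Function.update_of_ne (show 1 ≠ k by omega)]
  | fn i j => simp [Gen.eval, Function.update_of_ne (show 0 ≠ k by omega)]

lemma Monomial.eval_update {m : Monomial} {k : ℕ} (hk : 2 ≤ k) (hm : ∀ a ∈ m.gens, a.ord ≤ k)
    (z : Jet) (t : ℝ) : m.eval F (Function.update z k t) = m.eval F z := by
  have hprod (l : List Gen) (hl : ∀ a ∈ l, a.ord ≤ k) :
      (l.map (Gen.eval F)).prod (Function.update z k t) = (l.map (Gen.eval F)).prod z := by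
    induction l with
    | nil => rfl
    | cons a l ih =>
      obtain ⟨ha, hl⟩ := List.forall_mem_cons.1 hl
      simp [Gen.eval_update hk ha, ih hl]
  simp [Monomial.eval, hprod m.gens hm, Function.update_of_ne (show 1 ≠ k by omega)]

lemma DiffPoly.eval_update {P : DiffPoly} {k : ℕ} (hk : P.ord ≤ k) (z : Jet) (t : ℝ) :
    P.eval F (Function.update z k t) = P.eval F z := by
  have hle (n : ℕ) (hn : n ∈ 2 :: P.flatMap fun s => s.2.gens.map Gen.ord) : n ≤ k := by
    exact (List.le_max_of_le hn le_rfl).trans hk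
  have htwo : 2 ≤ k := hle _ List.mem_cons_self
  have hgen : ∀ s ∈ P, ∀ a ∈ s.2.gens, a.ord ≤ k := fun s hs a ha =>
    hle _ (List.mem_cons_of_mem _ (List.mem_flatMap.2 ⟨s, hs, List.mem_map_of_mem ha⟩))
  clear hk hle
  induction P with
  | nil => rfl
  | cons s P ih =>
    obtain ⟨hs, hP⟩ := List.forall_mem_cons.1 hgen
    simp [eval_cons, Monomial.eval_update htwo hs, ih hP]

lemma DiffPoly.pderiv_eval_of_ord_le {P : DiffPoly} {k : ℕ} (hk : P.ord ≤ k) :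
    pderiv k (P.eval F) = 0 := by
  funext z
  simp [pderiv, eval_update hk]

/-- On `Dom I` the differential polynomial `P` denotes the function `g`. -/
def Represents (I : Set ℝ) (F : Param → ℝ → ℝ) (P : DiffPoly) (g : JetFun) : Prop :=
  EqOn g (P.eval F) (Dom I)

namespace Represents

variable {P Q : DiffPoly} {g h : JetFun}

section Algebra

lemma zero : Represents I F 0 0 := fun _ _ => rfl

lemma jet (k : ℕ) : Represents I F (DiffPoly.jet k) (coord k) := fun _ _ =>
  (DiffPoly.eval_jet k).symm

lemma fn (i : Param) (j : ℕ) :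
    Represents I F (DiffPoly.fn i j) fun z => iteratedDeriv j (F i) (z 0) := fun _ _ =>
  (DiffPoly.eval_fn i j).symm

lemma add (hP : Represents I F P g) (hQ : Represents I F Q h) :
    Represents I F (P + Q) (g + h) := fun z hz => by
  rw [DiffPoly.eval_add, Pi.add_apply, Pi.add_apply, hP hz, hQ hz]

lemma sub (hP : Represents I F P g) (hQ : Represents I F Q h) :
    Represents I F (P - Q) (g - h) := fun z hz => by
  rw [DiffPoly.eval_sub hz.2, Pi.sub_apply, hP hz, hQ hz]

lemma neg (hP : Represents I F P g) : Represents I F (-P) (-g) := fun z hz => by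
  rw [DiffPoly.eval_neg hz.2, Pi.neg_apply, hP hz]

lemma mul (hP : Represents I F P g) (hQ : Represents I F Q h) :
    Represents I F (P * Q) (g * h) := fun z hz => by
  rw [DiffPoly.eval_mul hz.2, Pi.mul_apply, hP hz, hQ hz]

lemma smul (q : ℚ) (hP : Represents I F P g) : Represents I F (q • P) ((q : ℝ) • g) :=
  fun z hz => by rw [DiffPoly.eval_smul hz.2, Pi.smul_apply, hP hz, smul_eq_mul]

lemma pow (n : ℕ) (hP : Represents I F P g) : Represents I F (P ^ n) (g ^ n) := fun z hz => by
  rw [DiffPoly.eval_pow hz.2, Pi.pow_apply, hP hz]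

lemma sum_range {n : ℕ} {P : ℕ → DiffPoly} {g : ℕ → JetFun}
    (hP : ∀ k < n, Represents I F (P k) (g k)) :
    Represents I F ((List.range n).map P).sum fun z => ∑ k ∈ Finset.range n, g k z :=
  fun z hz => by
    rw [DiffPoly.eval_sum_range]
    exact Finset.sum_congr rfl fun k hk => hP k (Finset.mem_range.1 hk) hz

lemma eqOn_of_same (hP : Represents I F P g) (hQ : Represents I F Q h)
    (hPQ : P.same Q = true) : EqOn g h (Dom I) :=
  (hP.trans (DiffPoly.eqOn_of_same hPQ)).trans hQ.symm

end Algebra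

variable (hI : IsOpen I) (hF : ∀ i, ContDiffOn ℝ ∞ (F i) I)

include hI hF

protected lemma variation (hP : Represents I F P g) (hz : z ∈ Dom I) {h : Jet} {w : ℕ → DiffPoly}
    (hw : ∀ k, (w k).eval F z = h k) : variation h g z = (P.along w).eval F z :=
  (variation_congr hI hP h hz).trans (P.variation_eval hI hF hz hw)

protected lemma pderiv (hP : Represents I F P g) (k : ℕ) :
    Represents I F (P.pd k) (pderiv k g) := fun z hz => by
  rw [← variation_single]
  refine hP.variation hI hF hz fun j => ?_
  by_cases hj : j = k <;> simp [hj]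

protected lemma totalD (hP : Represents I F P g) : Represents I F P.total (totalD g) :=
  fun _ hz => hP.variation hI hF hz fun k => DiffPoly.eval_jet (k + 1)

lemma iterate_totalD (hP : Represents I F P g) (k : ℕ) :
    Represents I F (DiffPoly.total^[k] P) (totalD^[k] g) := by
  induction k with
  | zero => exact hP
  | succ k ih =>
    simp only [Function.iterate_succ_apply']
    exact ih.totalD hI hF

protected lemma evol {W : DiffPoly} {w : JetFun} (hW : Represents I F W w)
    (hP : Represents I F P g) : Represents I F (W.ev P) (evol w g) :=
  fun _ hz => hP.variation hI hF hz fun k => (hW.iterate_totalD hI hF k hz).symm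

omit hF in
lemma pderiv_eq_zero (hP : Represents I F P g) {k : ℕ} (hk : P.ord ≤ k) :
    EqOn (pderiv k g) 0 (Dom I) := fun z hz => by
  rw [pderiv_congr hI hP k hz, DiffPoly.pderiv_eval_of_ord_le hk]

protected lemma euler (hP : Represents I F P g) :
    Represents I F P.eulerLagrange (euler g) := fun z hz => by
  have hterm (k : ℕ) := ((hP.pderiv hI hF k).iterate_totalD hI hF k).smul ((-1) ^ k) hz
  rw [DiffPoly.eulerLagrange, DiffPoly.eval_sum_range]
  refine (finsum_eq_sum_range fun k hk => ?_).trans (Finset.sum_congr rfl fun k _ => ?_)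
  · simp [iterate_totalD_congr hI (hP.pderiv_eq_zero hI hk) k hz, iterate_totalD_zero]
  · simpa using hterm k

lemma totalD_euler (hP : Represents I F P g) : Represents I F P.ham (totalD (euler g)) :=
  (hP.euler hI hF).totalD hI hF

lemma secondVariation_prolong {W : DiffPoly} {w : JetFun} (hW : Represents I F W w)
    (hP : Represents I F P g) :
    Represents I F (P.second fun k => DiffPoly.total^[k] W)
      fun z => secondVariation (prolong w z) g z := fun z hz => by
  have hw (k : ℕ) := hW.iterate_totalD hI hF k hz
  rw [DiffPoly.second, DiffPoly.eval_sum_range]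
  refine (finsum_eq_sum_range fun k hk => ?_).trans (Finset.sum_congr rfl fun k _ => ?_)
  · rw [variation_congr hI (hP.pderiv_eq_zero hI hk) _ hz, Pi.zero_def, variation_const, mul_zero]
  · rw [DiffPoly.eval_mul hz.2, ← hw,
      ← (hP.pderiv hI hF k).variation hI hF hz fun j => (hw j).symm]
    rfl

protected lemma shiftCoeff {S₁ S₂ : DiffPoly} {T₁ T₂ : JetFun} (h₁ : Represents I F S₁ T₁)
    (h₂ : Represents I F S₂ T₂) (hP : Represents I F P g) :
    ∀ k, Represents I F (DiffPoly.shiftCoeff S₁ S₂ P k) (shiftCoeff T₁ T₂ g k)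
  | 0 => hP
  | 1 => h₁.evol hI hF hP
  | 2 => fun z hz => by
    simpa [shiftCoeff, DiffPoly.shiftCoeff] using
      (h₂.evol hI hF hP).add ((h₁.secondVariation_prolong hI hF hP).smul (1 / 2)) hz
  | _ + 3 => zero

end Represents

/-- On `Dom I` the coefficients of `ε⁰`, `ε²` and `ε⁴` in `G` are denoted by `P 0`, `P 1`, `P 2`. -/
def RepresentsSeries (I : Set ℝ) (F : Param → ℝ → ℝ) (P : ℕ → DiffPoly) (G : EpsFun) : Prop :=
  ∀ k < 3, Represents I F (P k) (PowerSeries.coeff (2 * k) G)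

namespace RepresentsSeries

variable {P Q : ℕ → DiffPoly} {G H : EpsFun} (hI : IsOpen I) (hF : ∀ i, ContDiffOn ℝ ∞ (F i) I)

include hI hF

protected lemma compCoeff (hP : RepresentsSeries I F P G) (hQ : RepresentsSeries I F Q H) {k : ℕ}
    (hk : k < 3) : Represents I F (DiffPoly.compCoeff P Q k) (compCoeff G H k) :=
  Represents.sum_range fun i hi =>
    (hP 1 (by lia)).shiftCoeff hI hF (hP 2 (by lia)) (hQ i (by lia)) (k - i)

protected lemma flowCoeff (hP : RepresentsSeries I F P G) (hQ : RepresentsSeries I F Q H) {k : ℕ}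
    (hk : k < 3) : Represents I F (DiffPoly.flowCoeff P Q k) (flowCoeff G H k) :=
  Represents.sum_range fun i hi => (hP (k - i) (by lia)).evol hI hF (hQ i (by lia))

end RepresentsSeries

/-! ### The identities between the coefficients -/

namespace DiffPoly

/-- The coefficient of `ε` in `densityK`. -/
def densityK₁ : DiffPoly := (1 / 24 : ℚ) • (fn .c 0 * ux 1 * gen .log)

/-- The coefficient of `ε³` in `densityK`. -/
def densityK₃ : DiffPoly :=
  (1 / 5760 : ℚ) • (fn .c 0 ^ 2 * jet 2 ^ 3 * ux (-3))
    - (1 / 4 : ℚ) • (fn .p 0 * jet 2 ^ 2 * ux (-1))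

/-- The coefficients of `densityH c p (sFun c) f`. -/
def densityH : ℕ → DiffPoly
  | 0 => fn .f 0
  | 1 => (-1 / 24 : ℚ) • (fn .c 0 * fn .f 3 * ux 2)
  | _ => (fn .p 0 * fn .f 3 + (1 / 480 : ℚ) • (fn .c 0 ^ 2 * fn .f 4)) * jet 2 ^ 2
    - ((1 / 1152 : ℚ) • (fn .c 0 * fn .c 2 * fn .f 4)
      + (1 / 1152 : ℚ) • (fn .c 0 * fn .c 1 * fn .f 5)
      + (1 / 3456 : ℚ) • (fn .c 0 ^ 2 * fn .f 6)
      + (1 / 6 : ℚ) • (fn .p 1 * fn .f 4) + (1 / 6 : ℚ) • (fn .p 0 * fn .f 5)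
      - (1 / 3456 : ℚ) • (fn .c 0 * fn .c 3 * fn .f 3)) * ux 4

/-- The expression `quasiBracket`. -/
def quasiBracket : DiffPoly :=
  fn .c 0 ^ 2 * total ((1 / 360 : ℚ) • (jet 2 ^ 3 * ux (-4))
      - (7 / 1920 : ℚ) • (jet 2 * jet 3 * ux (-3)) + (1 / 1152 : ℚ) • (jet 4 * ux (-2)))
    + fn .c 0 * fn .c 1 * ((47 / 5760 : ℚ) • (jet 2 ^ 3 * ux (-3))
      - (37 / 2880 : ℚ) • (jet 2 * jet 3 * ux (-2)) + (5 / 1152 : ℚ) • (jet 4 * ux (-1)))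
    + fn .c 1 ^ 2 * ((1 / 384 : ℚ) • jet 3 - (1 / 5760 : ℚ) • (jet 2 ^ 2 * ux (-1)))
    + fn .c 0 * fn .c 2 * ((1 / 144 : ℚ) • jet 3 - (1 / 360 : ℚ) • (jet 2 ^ 2 * ux (-1)))
    + (1 / 1152 : ℚ) • ((7 : ℚ) • (fn .c 1 * fn .c 2 * ux 1 * jet 2)
      + fn .c 2 ^ 2 * ux 3 + (6 : ℚ) • (fn .c 0 * fn .c 3 * ux 1 * jet 2)
      + fn .c 1 * fn .c 3 * ux 3 + fn .c 0 * fn .c 4 * ux 3)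
    + fn .p 0 * ((1 / 2 : ℚ) • (jet 2 ^ 3 * ux (-3))
      - jet 2 * jet 3 * ux (-2) + (1 / 2 : ℚ) • (jet 4 * ux (-1)))
    + fn .p 1 * jet 3 + (1 / 2 : ℚ) • (fn .p 2 * ux 1 * jet 2)

/-- The coefficients of `quasi`. -/
def quasi : ℕ → DiffPoly
  | 0 => jet 0
  | 1 => (1 / 24 : ℚ) • total (fn .c 0 * jet 2 * ux (-1) + fn .c 1 * ux 1)
  | _ => total quasiBracket

/-- The coefficients of the canonical transformation generated by a density `ε P + ε³ Q + ⋯` which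
is odd in `ε`. -/
def canonical (P Q : DiffPoly) : ℕ → DiffPoly
  | 0 => jet 0
  | 1 => ham P
  | _ => ham Q + (1 / 2 : ℚ) • (ham P).ev (ham P)

/-- The coefficients of `applyFun f` at a substitution with the coefficients `V`. -/
def applyFun (V : ℕ → DiffPoly) : ℕ → DiffPoly
  | 0 => fn .f 0
  | 1 => fn .f 1 * V 1
  | _ => fn .f 1 * V 2 + (1 / 2 : ℚ) • (fn .f 2 * V 1 ^ 2)

/-- The coefficients of the field `a(u) u_x` of the unperturbed equation, `a = f''`. -/
def transport : ℕ → DiffPoly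
  | 0 => fn .f 2 * ux 1
  | _ => 0

/-- Local functions whose total derivatives are the differences between the densities of `H_f` and
of `∫ f(v) dx`. The terms with `f'(u)` come from integrating `f'(u) {u(x), K}` by parts; the
others are then determined by comparing coefficients. -/
def primitive : ℕ → DiffPoly
  | 0 => 0
  | 1 => -(fn .f 1 * eulerLagrange densityK₁) - (1 / 24 : ℚ) • (fn .c 0 * fn .f 2 * ux 1)
  | _ => -(fn .f 1 * (eulerLagrange densityK₃
      + (1 / 2 : ℚ) • (ham densityK₁).ev (eulerLagrange densityK₁)))
    + fn .f 2 * ((7 / 5760 : ℚ) • (fn .c 0 ^ 2 * jet 2 ^ 3 * ux (-3))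
      + (1 / 2 : ℚ) • (fn .p 0 * jet 2 ^ 2 * ux (-1))
      - (7 / 2880 : ℚ) • (fn .c 0 ^ 2 * jet 2 * jet 3 * ux (-2))
      - (1 / 2 : ℚ) • (fn .p 0 * jet 3) - (1 / 640 : ℚ) • (fn .c 0 * fn .c 1 * jet 2 ^ 2 * ux (-1))
      + (1 / 384 : ℚ) • (fn .c 0 * fn .c 1 * jet 3) - (1 / 2 : ℚ) • (fn .p 1 * ux 1 * jet 2)
      + (1 / 1152 : ℚ) • (fn .c 0 ^ 2 * jet 4 * ux (-1))
      + (1 / 384 : ℚ) • (fn .c 0 * fn .c 2 * ux 1 * jet 2)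
      + (1 / 1152 : ℚ) • (fn .c 0 * fn .c 3 * ux 3))
    + fn .f 3 * ((7 / 5760 : ℚ) • (fn .c 0 ^ 2 * jet 2 ^ 2 * ux (-1))
      + (1 / 2 : ℚ) • (fn .p 0 * ux 1 * jet 2) - (1 / 1152 : ℚ) • (fn .c 0 ^ 2 * jet 3)
      - (1 / 1152 : ℚ) • (fn .c 0 * fn .c 1 * ux 1 * jet 2) + (1 / 3456 : ℚ) • (fn .c 1 ^ 2 * ux 3)
      - (1 / 1728 : ℚ) • (fn .c 0 * fn .c 2 * ux 3))
    + fn .f 4 * ((1 / 1152 : ℚ) • (fn .c 0 ^ 2 * ux 1 * jet 2) - (1 / 6 : ℚ) • (fn .p 0 * ux 3)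
      - (1 / 3456 : ℚ) • (fn .c 0 * fn .c 1 * ux 3))
    - (1 / 3456 : ℚ) • (fn .f 5 * fn .c 0 ^ 2 * ux 3)

set_option maxRecDepth 100000

lemma same_total_primitive : ∀ k < 3, same
    (densityH k - applyFun (canonical densityK₁ densityK₃) k) (total (primitive k)) = true := by
  decide +kernel

lemma same_canonical_neg_quasi :
    ∀ k < 3, same (canonical (-densityK₁) (-densityK₃) k) (quasi k) = true := by
  decide +kernel

lemma same_flowCoeff_quasi : ∀ k < 3, same (flowCoeff transport quasi k)
    (compCoeff quasi (fun i => ham (densityH i)) k) = true := by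
  decide +kernel

lemma same_flowCoeff_canonical : ∀ k < 3,
    same (flowCoeff (fun i => ham (densityH i)) (canonical densityK₁ densityK₃) k)
      (compCoeff (canonical densityK₁ densityK₃) transport k) = true := by
  decide +kernel

end DiffPoly

open PowerSeries (coeff monomial)

section Series

variable {I : Set ℝ} {F : Param → ℝ → ℝ} {P Q : ℕ → DiffPoly} {G H V κ : EpsFun}

lemma RepresentsSeries.monomial {h₀ h₂ h₄ : JetFun} (H₀ : Represents I F (P 0) h₀)
    (H₂ : Represents I F (P 1) h₂) (H₄ : Represents I F (P 2) h₄) :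
    RepresentsSeries I F P (monomial 0 h₀ + monomial 2 h₂ + monomial 4 h₄) := fun i hi => by
  interval_cases i <;>
    simpa [PowerSeries.coeff_monomial, -PowerSeries.coeff_zero_eq_constantCoeff]

lemma RepresentsSeries.applyFun (hV : IsSubstitution I V)
    (hP : RepresentsSeries I F P V) :
    RepresentsSeries I F (DiffPoly.applyFun P) (applyFun (F .f) V)
  | 0, _ => by simpa only [mul_zero, coeff_applyFun_zero, iteratedDeriv_zero] using .fn .f 0
  | 1, _ => by
    rw [hV.coeff_applyFun_two]
    exact (Represents.fn .f 1).mul (hP 1 (by lia))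
  | 2, _ => fun z hz => by
    rw [hV.coeff_applyFun_four]
    simpa [DiffPoly.applyFun] using ((Represents.fn .f 1).mul (hP 2 (by lia))).add
      ((((Represents.fn .f 2).mul ((hP 1 (by lia)).pow 2))).smul (1 / 2)) hz

lemma eqOn_coeff_of_same (hG : IsEvenLocal I G) (hH : IsEvenLocal I H)
    (hP : RepresentsSeries I F P G) (hQ : RepresentsSeries I F Q H)
    (hPQ : ∀ k < 3, (P k).same (Q k) = true) {k : ℕ} (hk : k < 6) :
    EqOn (coeff k G) (coeff k H) (Dom I) := by
  obtain ⟨i, rfl | rfl⟩ := k.even_or_odd'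
  · exact (hP i (by lia)).eqOn_of_same (hQ i (by lia)) (hPQ i (by lia))
  · rw [hG.coeff_odd i (by lia), hH.coeff_odd i (by lia)]
    exact eqOn_refl _ _

variable (hI : IsOpen I) (hF : ∀ i, ContDiffOn ℝ ∞ (F i) I)

include hI hF

lemma Represents.isLocal {P : DiffPoly} {g : JetFun} (hP : Represents I F P g) : IsLocal I g :=
  (P.isLocal_eval hI hF).congr hP

lemma RepresentsSeries.isEvenLocal (hP : RepresentsSeries I F P G)
    (hodd : ∀ i < 3, coeff (2 * i + 1) G = 0) : IsEvenLocal I G :=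
  ⟨hodd, fun i hi => (hP i hi).isLocal hI hF⟩

lemma RepresentsSeries.hamField (hP : RepresentsSeries I F P G) :
    RepresentsSeries I F (fun k => (P k).ham) (hamField G) := fun k hk => by
  rw [coeff_hamField]
  exact (hP k hk).totalD_euler hI hF

lemma RepresentsSeries.canonical {P₁ P₃ : DiffPoly} (hκ : ∀ n, Even n → coeff n κ = 0)
    (h₁ : Represents I F P₁ (coeff 1 κ)) (h₃ : Represents I F P₃ (coeff 3 κ)) :
    RepresentsSeries I F (DiffPoly.canonical P₁ P₃) (canonical κ)
  | 0, _ => by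
    rw [mul_zero, coeff_canonical_zero]
    exact .jet 0
  | 1, _ => by
    rw [coeff_canonical_two hκ, coeff_hamField]
    exact h₁.totalD_euler hI hF
  | 2, _ => by
    have hham := h₁.totalD_euler hI hF
    rw [coeff_canonical_four hκ, coeff_hamField, coeff_hamField]
    simpa [DiffPoly.canonical] using
      (h₃.totalD_euler hI hF).add ((hham.evol hI hF hham).smul (1 / 2))

lemma sameFunctional_of_same (hG : IsEvenLocal I G) (hH : IsEvenLocal I H)
    (hP : RepresentsSeries I F P G) (hQ : RepresentsSeries I F Q H) {R : ℕ → DiffPoly}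
    (hPQ : ∀ k < 3, (P k - Q k).same (R k).total = true) {k : ℕ} (hk : k < 6) :
    SameFunctional I (coeff k G) (coeff k H) := by
  obtain ⟨i, rfl | rfl⟩ := k.even_or_odd'
  · have hR : Represents I F (R i) ((R i).eval F) := eqOn_refl _ _
    exact ⟨_, (R i).isLocal_eval hI hF, ((hP i (by lia)).sub (hQ i (by lia))).eqOn_of_same
      (hR.totalD hI hF) (hPQ i (by lia))⟩
  · refine ⟨0, .const I 0, fun z _ => ?_⟩
    rw [hG.coeff_odd i (by lia), hH.coeff_odd i (by lia), totalD_zero, sub_self]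
    rfl

end Series

/-- The functions named by `Param`. -/
def params (c p f : ℝ → ℝ) : Param → ℝ → ℝ
  | .c => c
  | .p => p
  | .f => f

/-- The field `a(u) u_x`, `a = f''`, of the unperturbed equation. -/
def transportField (f : ℝ → ℝ) : EpsFun :=
  monomial 0 fun z : Jet => iteratedDeriv 2 f (z 0) * z 1

lemma solvesUnperturbed_iff {f : ℝ → ℝ} {Ω : Set (ℝ × ℝ)} {w : ℝ → ℝ → ℝ → ℝ} :
    SolvesUnperturbed (iteratedDeriv 2 f) Ω w ↔ SolvesEvolution (transportField f) Ω w := by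
  have heval (ε : ℝ) (z : Jet) :
      eval6 (transportField f) ε z = iteratedDeriv 2 f (z 0) * z 1 := by
    simp [eval6, transportField, Finset.sum_range_succ,
      -PowerSeries.coeff_zero_eq_constantCoeff]
  simp only [SolvesUnperturbed, SolvesEvolution, heval, jet, iteratedDeriv_zero, iteratedDeriv_one]

section Densities

variable {I : Set ℝ} {c p f : ℝ → ℝ}

lemma contDiffOn_params (hc : ContDiffOn ℝ ∞ c I) (hp : ContDiffOn ℝ ∞ p I)
    (hf : ContDiffOn ℝ ∞ f I) : ∀ i, ContDiffOn ℝ ∞ (params c p f i) I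
  | .c => hc
  | .p => hp
  | .f => hf

lemma coeff_densityK_of_even (c p : ℝ → ℝ) (n : ℕ) (hn : Even n) : coeff n (densityK c p) = 0 := by
  have h₁ : n ≠ 1 := by rintro rfl; exact absurd hn (by decide)
  have h₃ : n ≠ 3 := by rintro rfl; exact absurd hn (by decide)
  simp [densityK, PowerSeries.coeff_monomial, h₁, h₃]

lemma coeff_neg_densityK_of_even (c p : ℝ → ℝ) (n : ℕ) (hn : Even n) :
    coeff n (-densityK c p) = 0 := by
  rw [map_neg, coeff_densityK_of_even c p n hn, neg_zero]

lemma represents_densityK₁ :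
    Represents I (params c p f) DiffPoly.densityK₁ (coeff 1 (densityK c p)) := fun z hz => by
  simp only [densityK, map_add, PowerSeries.coeff_monomial_same, PowerSeries.coeff_monomial,
    OfNat.one_ne_ofNat, ↓reduceIte, add_zero, DiffPoly.densityK₁, DiffPoly.eval_smul hz.2,
    DiffPoly.eval_mul hz.2, DiffPoly.eval_fn, DiffPoly.eval_ux, DiffPoly.eval_gen, Gen.eval,
    params, iteratedDeriv_zero, zpow_ofNat]
  push_cast
  ring

lemma represents_densityK₃ :
    Represents I (params c p f) DiffPoly.densityK₃ (coeff 3 (densityK c p)) := fun z hz => by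
  simp only [densityK, map_add, PowerSeries.coeff_monomial_same, PowerSeries.coeff_monomial,
    OfNat.ofNat_ne_one, ↓reduceIte, zero_add, DiffPoly.densityK₃, DiffPoly.eval_sub hz.2,
    DiffPoly.eval_smul hz.2, DiffPoly.eval_mul hz.2, DiffPoly.eval_pow hz.2, DiffPoly.eval_fn,
    DiffPoly.eval_jet, DiffPoly.eval_ux, params, iteratedDeriv_zero, Int.reduceNeg,
    zpow_neg, zpow_ofNat]
  push_cast
  ring

lemma representsSeries_densityH : RepresentsSeries I (params c p f) DiffPoly.densityH
    (densityH c p (sFun c) f) := by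
  refine .monomial (.fn .f 0) (fun z hz => ?_) fun z hz => ?_
  all_goals
    simp only [DiffPoly.densityH, sFun, DiffPoly.eval_smul hz.2, DiffPoly.eval_mul hz.2,
      DiffPoly.eval_add, Pi.add_apply, DiffPoly.eval_sub hz.2, DiffPoly.eval_pow hz.2,
      DiffPoly.eval_fn, DiffPoly.eval_ux, DiffPoly.eval_jet, params, iteratedDeriv_zero,
      zpow_ofNat]
    push_cast
    ring

lemma coeff_transportField_of_ne_zero (f : ℝ → ℝ) {n : ℕ} (hn : n ≠ 0) :
    coeff n (transportField f) = 0 :=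
  (PowerSeries.coeff_monomial ..).trans (if_neg hn)

lemma representsSeries_transportField :
    RepresentsSeries I (params c p f) DiffPoly.transport (transportField f)
  | 0, _ => by
    rw [transportField, mul_zero, PowerSeries.coeff_monomial_same]
    exact .mul (.fn .f 2) (.jet 1)
  | n + 1, _ => by
    rw [coeff_transportField_of_ne_zero f (by lia)]
    exact .zero

variable (hI : IsOpen I) (hF : ∀ i, ContDiffOn ℝ ∞ (params c p f i) I)

include hI hF

lemma represents_quasiBracket :
    Represents I (params c p f) DiffPoly.quasiBracket (quasiBracket c p) := fun z hz => by
  have hinner : Represents I (params c p f) ((1 / 360 : ℚ) • (.jet 2 ^ 3 * .ux (-4))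
      - (7 / 1920 : ℚ) • (.jet 2 * .jet 3 * .ux (-3)) + (1 / 1152 : ℚ) • (.jet 4 * .ux (-2)))
      fun y => y 2 ^ 3 / (360 * y 1 ^ 4) - 7 * y 2 * y 3 / (1920 * y 1 ^ 3)
        + y 4 / (1152 * y 1 ^ 2) := fun y hy => by
    simp only [DiffPoly.eval_smul hy.2, DiffPoly.eval_mul hy.2, DiffPoly.eval_add, Pi.add_apply,
      DiffPoly.eval_sub hy.2, DiffPoly.eval_pow hy.2, DiffPoly.eval_ux, DiffPoly.eval_jet,
      Int.reduceNeg, zpow_neg, zpow_ofNat]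
    push_cast
    ring
  rw [quasiBracket, hinner.totalD hI hF hz]
  simp only [DiffPoly.quasiBracket, DiffPoly.eval_smul hz.2, DiffPoly.eval_mul hz.2,
    DiffPoly.eval_add, Pi.add_apply, DiffPoly.eval_sub hz.2, DiffPoly.eval_pow hz.2,
    DiffPoly.eval_fn, DiffPoly.eval_ux, DiffPoly.eval_jet, params, iteratedDeriv_zero,
    Int.reduceNeg, zpow_neg, zpow_ofNat]
  push_cast
  ring

lemma representsSeries_quasi : RepresentsSeries I (params c p f) DiffPoly.quasi (quasi c p) := by
  have hinner : Represents I (params c p f) (.fn .c 0 * .jet 2 * .ux (-1) + .fn .c 1 * .ux 1)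
      fun y => c (y 0) * (y 2 / y 1) + iteratedDeriv 1 c (y 0) * y 1 := fun y hy => by
    simp only [DiffPoly.eval_mul hy.2, DiffPoly.eval_add, Pi.add_apply, DiffPoly.eval_fn,
      DiffPoly.eval_ux, DiffPoly.eval_jet, params, iteratedDeriv_zero, Int.reduceNeg,
      zpow_neg, zpow_ofNat]
    ring
  refine .monomial (.jet 0) (fun z hz => ?_) ((represents_quasiBracket hI hF).totalD hI hF)
  simpa [DiffPoly.quasi] using (hinner.totalD hI hF).smul (1 / 24) hz

lemma representsSeries_canonical : RepresentsSeries I (params c p f)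
    (DiffPoly.canonical DiffPoly.densityK₁ DiffPoly.densityK₃) (canonical (densityK c p)) :=
  .canonical hI hF (coeff_densityK_of_even c p) represents_densityK₁ represents_densityK₃

lemma representsSeries_canonical_neg : RepresentsSeries I (params c p f)
    (DiffPoly.canonical (-DiffPoly.densityK₁) (-DiffPoly.densityK₃))
    (canonical (-densityK c p)) :=
  .canonical hI hF (coeff_neg_densityK_of_even c p)
    (by rw [map_neg]; exact represents_densityK₁.neg)
    (by rw [map_neg]; exact represents_densityK₃.neg)

end Densities

/-! ### The quasitriviality transformation -/

section Transformation

variable {I : Set ℝ} {c p f : ℝ → ℝ} {Ω : Set (ℝ × ℝ)} {w : ℝ → ℝ → ℝ → ℝ} (hI : IsOpen I)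
  (hc : ContDiffOn ℝ ∞ c I) (hp : ContDiffOn ℝ ∞ p I)

include hI hc hp

lemma isSubstitution_canonical_densityK : IsSubstitution I (canonical (densityK c p)) :=
  have hF := contDiffOn_params hc hp (contDiffOn_const (c := 0))
  isSubstitution_canonical (coeff_densityK_of_even c p) hI
    (represents_densityK₁.isLocal hI hF) (represents_densityK₃.isLocal hI hF)

lemma isSubstitution_quasi : IsSubstitution I (quasi c p) where
  __ :=
    have hF := contDiffOn_params hc hp (contDiffOn_const (c := 0))
    (representsSeries_quasi hI hF).isEvenLocal hI hF fun i _ => coeff_monomial_odd _ _ _ i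
  coeff_zero := by simp [quasi, PowerSeries.coeff_monomial,
    -PowerSeries.coeff_zero_eq_constantCoeff]

theorem eqOn_coeff_canonical_neg_densityK {k : ℕ} (hk : k < 6) :
    EqOn (coeff k (canonical (-densityK c p))) (coeff k (quasi c p)) (Dom I) := by
  have hF := contDiffOn_params hc hp (contDiffOn_const (c := 0))
  have hcanonical := representsSeries_canonical_neg hI hF
  exact eqOn_coeff_of_same (hcanonical.isEvenLocal hI hF fun i _ =>
    coeff_canonical_odd (coeff_neg_densityK_of_even c p) (odd_two_mul_add_one i))
    (isSubstitution_quasi hI hc hp).toIsEvenLocal hcanonical (representsSeries_quasi hI hF)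
    DiffPoly.same_canonical_neg_quasi hk

section Inverse

variable {v : ℝ → ℝ} {A : Set ℝ} (hA : IsOpen A) (hv : ContDiffOn ℝ ∞ v A)
  (hD : ∀ x ∈ A, jet v x ∈ Dom I) {x : ℝ} (hx : x ∈ A)

include hA hv hD hx

theorem quasi_canonical_sub_isBigO :
    (fun ε => eval6 (quasi c p) ε
      (jet (fun y => eval6 (canonical (densityK c p)) ε (jet v y)) x) - v x)
      =O[𝓝 0] fun ε : ℝ => ε ^ 6 :=
  eval6_eval6_sub_isBigO hI (isSubstitution_canonical_densityK hI hc hp)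
    (isSubstitution_quasi hI hc hp)
    (compCoeff_eq_zero_of_canonical (coeff_densityK_of_even c p) hI
      (isSubstitution_quasi hI hc hp) (fun _ _ => eqOn_refl _ _)
      fun _ hk => (eqOn_coeff_canonical_neg_densityK hI hc hp hk).symm) hA hv hD hx

theorem canonical_quasi_sub_isBigO :
    (fun ε => eval6 (canonical (densityK c p)) ε
      (jet (fun y => eval6 (quasi c p) ε (jet v y)) x) - v x)
      =O[𝓝 0] fun ε : ℝ => ε ^ 6 :=
  eval6_eval6_sub_isBigO hI (isSubstitution_quasi hI hc hp)
    (isSubstitution_canonical_densityK hI hc hp)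
    (compCoeff_eq_zero_of_canonical (coeff_neg_densityK_of_even c p) hI
      (isSubstitution_canonical_densityK hI hc hp)
      (fun _ hk => (eqOn_coeff_canonical_neg_densityK hI hc hp hk).symm)
      fun _ _ => by rw [neg_neg]; exact eqOn_refl _ _) hA hv hD hx

end Inverse

variable (hf : ContDiffOn ℝ ∞ f I)

include hf

lemma isEvenLocal_densityH : IsEvenLocal I (densityH c p (sFun c) f) :=
  representsSeries_densityH.isEvenLocal hI (contDiffOn_params hc hp hf) fun i _ =>
    coeff_monomial_odd _ _ _ i

theorem sameFunctional_densityH {k : ℕ} (hk : k < 6) : SameFunctional I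
    (coeff k (densityH c p (sFun c) f)) (coeff k (applyFun f (canonical (densityK c p)))) := by
  have hF := contDiffOn_params hc hp hf
  have hV := isSubstitution_canonical_densityK hI hc hp
  have happly := (representsSeries_canonical hI hF).applyFun hV
  exact sameFunctional_of_same hI hF (isEvenLocal_densityH hI hc hp hf)
    (happly.isEvenLocal hI hF (hV.coeff_applyFun_odd f)) representsSeries_densityH happly
    DiffPoly.same_total_primitive hk

theorem SolvesUnperturbed.substitute_quasi (hΩ : IsOpen Ω) (hw : IsMonotoneFamily I Ω w)
    (hsol : SolvesUnperturbed (iteratedDeriv 2 f) Ω w) :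
    SolvesHamiltonian (densityH c p (sFun c) f) Ω (substitute (quasi c p) w) := by
  have hF := contDiffOn_params hc hp hf
  have hB := representsSeries_transportField (c := c) (p := p) (f := f) (I := I)
  have hA := representsSeries_densityH.hamField hI hF
  have hV := representsSeries_quasi hI hF
  exact (solvesUnperturbed_iff.1 hsol).substitute hI
    ((isEvenLocal_densityH hI hc hp hf).hamField hI)
    (hB.isEvenLocal hI hF fun _ _ => coeff_transportField_of_ne_zero f (by lia))
    (isSubstitution_quasi hI hc hp)
    (fun k hk => (hB.flowCoeff hI hF hV hk).eqOn_of_same (hV.compCoeff hI hF hA hk)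
      (DiffPoly.same_flowCoeff_quasi k hk)) hΩ hw

theorem SolvesHamiltonian.substitute_canonical (hΩ : IsOpen Ω) (hw : IsMonotoneFamily I Ω w)
    (hsol : SolvesHamiltonian (densityH c p (sFun c) f) Ω w) :
    SolvesUnperturbed (iteratedDeriv 2 f) Ω (substitute (canonical (densityK c p)) w) := by
  have hF := contDiffOn_params hc hp hf
  have hA := representsSeries_transportField (c := c) (p := p) (f := f) (I := I)
  have hB := representsSeries_densityH.hamField hI hF
  have hV := representsSeries_canonical hI hF
  exact solvesUnperturbed_iff.2 <| SolvesEvolution.substitute hI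
    (hA.isEvenLocal hI hF fun _ _ => coeff_transportField_of_ne_zero f (by lia))
    ((isEvenLocal_densityH hI hc hp hf).hamField hI) (isSubstitution_canonical_densityK hI hc hp)
    (fun k hk => (hB.flowCoeff hI hF hV hk).eqOn_of_same (hV.compCoeff hI hF hA hk)
      (DiffPoly.same_flowCoeff_canonical k hk)) hΩ hw hsol

end Transformation

end Quasitriviality

end

theorem mainTheorem1 (I : Set ℝ) (hI : IsOpen I) (c p : ℝ → ℝ)
    (hc : ContDiffOn ℝ ∞ c I) (hp : ContDiffOn ℝ ∞ p I) :
    -- the canonical transformation generated by `K` turns every `H_f` into `∫ f(v) dx`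
    (∀ f : ℝ → ℝ, ContDiffOn ℝ ∞ f I → ∀ k < 6,
      SameFunctional I
        (PowerSeries.coeff k (densityH c p (sFun c) f))
        (PowerSeries.coeff k (applyFun f (canonical (densityK c p))))) ∧
    -- the transformation generated by `-K` is given by the explicit rational substitution
    (∀ k < 6, ∀ z ∈ Dom I,
      PowerSeries.coeff k (canonical (-densityK c p)) z = PowerSeries.coeff k (quasi c p) z) ∧
    -- the two substitutions are inverse to each other
    (∀ (w : ℝ → ℝ) (A : Set ℝ), IsOpen A → ContDiffOn ℝ ∞ w A →
      (∀ x ∈ A, w x ∈ I ∧ deriv w x ≠ 0) → ∀ x ∈ A,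
        ((fun ε => eval6 (quasi c p) ε
            (jet (fun y => eval6 (canonical (densityK c p)) ε (jet w y)) x) - w x)
          =O[𝓝 0] fun ε : ℝ => ε ^ 6) ∧
        ((fun ε => eval6 (canonical (densityK c p)) ε
            (jet (fun y => eval6 (quasi c p) ε (jet w y)) x) - w x)
          =O[𝓝 0] fun ε : ℝ => ε ^ 6)) ∧
    -- monotone solutions go to solutions modulo `O(ε⁶)`, simultaneously for all `f`
    (∀ f : ℝ → ℝ, ContDiffOn ℝ ∞ f I → ∀ Ω : Set (ℝ × ℝ), IsOpen Ω →
      -- exact solutions of the unperturbed equation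
      (∀ v : ℝ → ℝ → ℝ, ContDiffOn ℝ ∞ (fun q : ℝ × ℝ => v q.1 q.2) Ω →
        (∀ x s, (x, s) ∈ Ω → v x s ∈ I ∧ deriv (fun y => v y s) x ≠ 0 ∧
          deriv (fun σ => v x σ) s + iteratedDeriv 2 f (v x s) * deriv (fun y => v y s) x = 0) →
        SolvesHamiltonian (densityH c p (sFun c) f) Ω
          (substitute (quasi c p) (fun _ => v))) ∧
      -- solutions of the unperturbed equation modulo `O(ε⁶)`
      (∀ v : ℝ → ℝ → ℝ → ℝ, IsMonotoneFamily I Ω v →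
        SolvesUnperturbed (iteratedDeriv 2 f) Ω v →
        SolvesHamiltonian (densityH c p (sFun c) f) Ω (substitute (quasi c p) v)) ∧
      -- and vice versa
      (∀ u : ℝ → ℝ → ℝ → ℝ, IsMonotoneFamily I Ω u →
        SolvesHamiltonian (densityH c p (sFun c) f) Ω u →
        SolvesUnperturbed (iteratedDeriv 2 f) Ω
          (substitute (canonical (densityK c p)) u))) := by
  refine ⟨fun f hf k hk => sameFunctional_densityH hI hc hp hf hk,
    fun k hk z hz => eqOn_coeff_canonical_neg_densityK hI hc hp hk hz,
    fun w A hA hw hwA x hx => ?_, fun f hf Ω hΩ => ⟨fun v hv hsol => ?_,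
      fun v hv hsol => hsol.substitute_quasi hI hc hp hf hΩ hv,
      fun u hu hsol => hsol.substitute_canonical hI hc hp hf hΩ hu⟩⟩
  · have hD : ∀ x ∈ A, jet w x ∈ Dom I := by simpa [Dom, jet] using hwA
    exact ⟨quasi_canonical_sub_isBigO hI hc hp hA hw hD hx,
      canonical_quasi_sub_isBigO hI hc hp hA hw hD hx⟩
  · have hfamily : IsMonotoneFamily I Ω fun _ => v :=
      ⟨⟨univ ×ˢ Ω, isOpen_univ.prod hΩ, fun q hq => ⟨mem_univ _, hq⟩,
        hv.comp contDiff_snd.contDiffOn fun r hr => hr.2⟩,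
        fun x s hq => ⟨(hsol x s hq).1, (hsol x s hq).2.1⟩⟩
    have hunperturbed : SolvesUnperturbed (iteratedDeriv 2 f) Ω fun _ => v := fun x s hq => by
      simpa only [(hsol x s hq).2.2] using isBigO_zero _ _
    exact hunperturbed.substitute_quasi hI hc hp hf hΩ hfamily
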